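/- Let $a\ge b\ge 1$ be integers. For a commutative ring $R$ let $S^R=R[x_0,\dots,x_a,y_0,\dots,y_b]$ with the standard grading, and let $I^R(a,b)\subset S^R$ be the ideal generated by the $2\times2$ minors of $$\begin{pmatrix}x_0&x_1&\cdots&x_{a-1}\\x_1&x_2&\cdots&x_a\end{pmatrix}\quad\text{and}\quad\begin{pmatrix}y_0&y_1&\cdots&y_{b-1}\\y_1&y_2&\cdots&y_b\end{pmatrix}$$ together with - the forms $x_{i+2}y_j-2x_{i+1}y_{j+1}+x_iy_{j+2}$ for $0\le i\le a-2$, $0\le j\le b-2$, if $b\ge2$; - the forms $x_{i+2}y_0^2-2x_{i+1}y_0y_1+x_iy_1^2$ for $0\le i\le a-2$, if $a\ge 2$ and $b=1$; - the form $(x_1y_0-x_0y_1)^2$, if $a=b=1$. The K3 carpet $X^R(a,b)\subset\mathbb P^{a+b+1}_R$ is the subscheme defined by $I^R(a,b)$, with homogeneous coordinate ring $P^R(a,b)=S^R/I^R(a,b)$. For a graded free $S^R$-resolution $F$ of $P^R(a,b)$, where $R$ is a field or $\mathbb Z$ and $R=S^R/(x_0,\dots,x_a,y_0,\dots,y_b)$,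 let $\beta_{i,j}(F)$ be the rank over $R$ of the degree $j$ part of $F_i\otimes_{S^R}R$. The $k$-th constant strand $F^{(k)}$ is the complex of $R$-modules formed by the part of internal degree $k$ of $F\otimes_{S^R}R$; its $i$-th term is free of rank $\beta_{i,k}(F)$. If $\mathbb F$ is a field, one says that $X^{\mathbb F}(a,b)$ satisfies Green's conjecture if the minimal graded free resolution $F'$ of $P^{\mathbb F}(a,b)$ over $S^{\mathbb F}$ has $\beta_{i,i+1}(F')=0$ for all $i\ge\max(a,b)=a$. **Proposition.** Let $\mathbb F$ be a field and $a\ge b\ge1$. Then $X^{\mathbb F}(a,b)$ satisfies Green's conjecture if and only if $H_a(F^{(a+1)}\otimes_{\mathbb Z}\mathbb F)=0$ for every graded free resolution $F$ of $P^{\mathbb Z}(a,b)$ over $S^{\mathbb Z}$. Moreover it suffices to check one resolution: for each single graded free resolution $F$ of $P^{\mathbb Z}(a,b)$, the carpet $X^{\mathbb F}(a,b)$ satisfies Green's conjecture if and only if $H_a(F^{(a+1)}\otimes_{\mathbb Z}\mathbb F)=0$. -/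

import Mathlib

/-!
# K3 carpets, graded free resolutions and their constant strands
-/

universe w u v

namespace K3Carpet

open MvPolynomial TensorProduct

/-- The polynomial ring `R[x_0, …, x_a, y_0, …, y_b]`: `x_i` is `X (Sum.inl i)` and
`y_j` is `X (Sum.inr j)`. -/
abbrev CoordPoly (R : Type*) [CommRing R] (a b : ℕ) : Type _ :=
  MvPolynomial (Fin (a + 1) ⊕ Fin (b + 1)) R

section Carpet

variable (R : Type*) [CommRing R] (a b : ℕ)

/-- The `2 × a` matrix with rows `x_0, …, x_{a-1}` and `x_1, …, x_a`. -/
noncomputable def MX : Matrix (Fin 2) (Fin a) (CoordPoly R a b) :=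
  Matrix.of ![fun j => X (Sum.inl j.castSucc), fun j => X (Sum.inl j.succ)]

/-- The `2 × b` matrix with rows `y_0, …, y_{b-1}` and `y_1, …, y_b`. -/
noncomputable def MY : Matrix (Fin 2) (Fin b) (CoordPoly R a b) :=
  Matrix.of ![fun j => X (Sum.inr j.castSucc), fun j => X (Sum.inr j.succ)]

/-- The ideal generated by the `2 × 2` minors of a matrix with two rows. -/
noncomputable def minorsIdeal {S : Type*} [CommRing S] {n : ℕ} (M : Matrix (Fin 2) (Fin n) S) :
    Ideal S :=
  Ideal.span {q | ∃ j k : Fin n, q = (M.submatrix id ![j, k]).det}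

/-- The bilinear forms `x_{i+2} y_j - 2 x_{i+1} y_{j+1} + x_i y_{j+2}` with `0 ≤ i ≤ a - 2` and
`0 ≤ j ≤ b - 2`. There are some only if `a, b ≥ 2`. -/
def bilinearForms : Set (CoordPoly R a b) :=
  {q | ∃ (i j : ℕ) (hi : i + 2 ≤ a) (hj : j + 2 ≤ b),
    q = X (Sum.inl ⟨i + 2, by omega⟩) * X (Sum.inr ⟨j, by omega⟩)
      - 2 * X (Sum.inl ⟨i + 1, by omega⟩) * X (Sum.inr ⟨j + 1, by omega⟩)
      + X (Sum.inl ⟨i, by omega⟩) * X (Sum.inr ⟨j + 2, by omega⟩)}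

/-- For `a ≥ 2` and `b = 1`: the cubic forms `x_{i+2} y_0^2 - 2 x_{i+1} y_0 y_1 + x_i y_1^2` with
`0 ≤ i ≤ a - 2`. -/
def cubicForms : Set (CoordPoly R a b) :=
  {q | ∃ (i : ℕ) (hi : i + 2 ≤ a) (_ : b = 1),
    q = X (Sum.inl ⟨i + 2, by omega⟩) * X (Sum.inr ⟨0, by omega⟩) ^ 2
      - 2 * X (Sum.inl ⟨i + 1, by omega⟩) * X (Sum.inr ⟨0, by omega⟩) * X (Sum.inr ⟨1, by omega⟩)
      + X (Sum.inl ⟨i, by omega⟩) * X (Sum.inr ⟨1, by omega⟩) ^ 2}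

/-- For `a = b = 1`: the quartic form `x_1^2 y_0^2 - 2 x_0 x_1 y_0 y_1 + x_0^2 y_1^2`. -/
def quarticForms : Set (CoordPoly R a b) :=
  {q | ∃ (_ : a = 1) (_ : b = 1),
    q = X (Sum.inl ⟨1, by omega⟩) ^ 2 * X (Sum.inr ⟨0, by omega⟩) ^ 2
      - 2 * X (Sum.inl ⟨0, by omega⟩) * X (Sum.inl ⟨1, by omega⟩)
          * X (Sum.inr ⟨0, by omega⟩) * X (Sum.inr ⟨1, by omega⟩)
      + X (Sum.inl ⟨0, by omega⟩) ^ 2 * X (Sum.inr ⟨1, by omega⟩) ^ 2}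

/-- The homogeneous ideal of the K3 carpet `X^R(a,b)` in `R[x_0, …, x_a, y_0, …, y_b]`, for
`a ≥ b ≥ 1`. Exactly one of the last three sets is nonempty. -/
noncomputable def carpetIdeal : Ideal (CoordPoly R a b) :=
  minorsIdeal (MX R a b) ⊔ minorsIdeal (MY R a b) ⊔
    Ideal.span (bilinearForms R a b ∪ cubicForms R a b ∪ quarticForms R a b)

end Carpet

/-- `p` is homogeneous of degree `n`, where `n` is an integer: all its monomials have degree `n`.
(For `n < 0` only `p = 0` qualifies.) -/
def HomogeneousOfDegree {σ R : Type*} [CommRing R] (p : MvPolynomial σ R) (n : ℤ) : Prop :=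
  ∀ m ∈ p.support, ((m.degree : ℕ) : ℤ) = n

/-- A graded free resolution `⋯ → F_2 → F_1 → F_0 → P/I → 0` of the graded module `P/I` over the
standard graded ring `P = R[σ]`. The module `F_i` is the graded free module `⨁_{l ∈ ι i} P(-deg l)`:
it is free on `ι i` and the basis element `l` has degree `deg i l`. The maps are homogeneous of
degree `0`. Neither the ranks nor the length are assumed to be finite. -/
structure GradedFreeResolution {R : Type u} [CommRing R] {σ : Type v}
    (I : Ideal (MvPolynomial σ R)) where
  /-- the index set of the homogeneous basis of `F_i` -/
  ι : ℕ → Type w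
  /-- the degrees of the basis elements of `F_i` -/
  deg : ∀ i, ι i → ℤ
  /-- the differential `F_{i+1} → F_i` -/
  d : ∀ i, (ι (i + 1) →₀ MvPolynomial σ R) →ₗ[MvPolynomial σ R] (ι i →₀ MvPolynomial σ R)
  /-- the augmentation `F_0 → P/I` -/
  ε : (ι 0 →₀ MvPolynomial σ R) →ₗ[MvPolynomial σ R] (MvPolynomial σ R ⧸ I)
  d_homogeneous : ∀ i (m : ι (i + 1)) (l : ι i),
    HomogeneousOfDegree (d i (Finsupp.single m 1) l) (deg (i + 1) m - deg i l)
  ε_homogeneous : ∀ l : ι 0, ∃ p : MvPolynomial σ R,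
    HomogeneousOfDegree p (deg 0 l) ∧ ε (Finsupp.single l 1) = Ideal.Quotient.mk I p
  ε_surjective : Function.Surjective ε
  exact_zero : Function.Exact (d 0) ε
  exact_succ : ∀ i, Function.Exact (d (i + 1)) (d i)

/-- The quotient `Z / B` of a submodule `B` contained in `Z` (in general, `Z / (Z ∩ B)`). -/
abbrev Subquotient {K M : Type*} [CommRing K] [AddCommGroup M] [Module K M]
    (Z B : Submodule K M) : Type _ :=
  Z ⧸ B.submoduleOf Z

namespace GradedFreeResolution

variable {R : Type u} [CommRing R] {σ : Type v} {I : Ideal (MvPolynomial σ R)}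
  (F : GradedFreeResolution.{w} I)

/-- The resolution is minimal: `d(F_{i+1}) ⊆ P_+ F_i` for all `i`, that is, no matrix entry of a
differential has a constant term. -/
def IsMinimal : Prop :=
  ∀ i (m : F.ι (i + 1)) (l : F.ι i), constantCoeff (F.d i (Finsupp.single m 1) l) = 0

/-- The `i`-th term of the `k`-th constant strand `F^{(k)}`: the part of degree `k` of `F_i ⊗_P R`,
where `R = P/P_+`; it is the free `R`-module on the basis elements of `F_i` of degree `k`. -/
abbrev constantStrand (k : ℤ) (i : ℕ) : Type _ :=
  {l : F.ι i // F.deg i l = k} →₀ R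

/-- The graded Betti number `β_{i,j}(F)`: the rank over `R` of the degree `j` part of
`F_i ⊗_P R`. -/
noncomputable def betti (i : ℕ) (j : ℤ) : Cardinal :=
  Module.rank R (F.constantStrand j i)

/-- The differential of the `k`-th constant strand, induced by that of `F ⊗_P R`: its matrix
entries are the constant terms of the entries of `F_{i+1} → F_i` between generators of
degree `k`. -/
noncomputable def constantStrandD (k : ℤ) (i : ℕ) :
    F.constantStrand k (i + 1) →ₗ[R] F.constantStrand k i :=
  Finsupp.linearCombination R fun m =>
    ((F.d i (Finsupp.single m.1 1)).mapRange constantCoeff (map_zero _)).subtypeDomain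
      fun l => F.deg i l = k

variable (K : Type*) [CommRing K] [Algebra R K]

/-- The cycles of `F^{(k)} ⊗_R K` in homological degree `i`. -/
noncomputable def strandCycles (k : ℤ) : ∀ i : ℕ, Submodule K (K ⊗[R] F.constantStrand k i)
  | 0 => ⊤
  | i + 1 => LinearMap.ker ((F.constantStrandD k i).baseChange K)

/-- The boundaries of `F^{(k)} ⊗_R K` in homological degree `i`. -/
noncomputable def strandBoundaries (k : ℤ) (i : ℕ) : Submodule K (K ⊗[R] F.constantStrand k i) :=
  LinearMap.range ((F.constantStrandD k i).baseChange K)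

/-- The homology `H_i(F^{(k)} ⊗_R K)`: cycles modulo boundaries. -/
abbrev strandHomology (k : ℤ) (i : ℕ) : Type _ :=
  Subquotient (F.strandCycles K k i) (F.strandBoundaries K k i)

end GradedFreeResolution

/-- The K3 carpet `X^K(a,b)` over the field `K` satisfies Green's conjecture: the minimal graded
free resolution of its homogeneous coordinate ring has `β_{i,i+1} = 0` for all `i ≥ max(a,b)`.
(The minimal resolution exists and is unique up to isomorphism.) -/
def SatisfiesGreen (K : Type u) [Field K] (a b : ℕ) : Prop :=
  ∃ F : GradedFreeResolution.{0} (carpetIdeal K a b), F.IsMinimal ∧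
    ∀ i : ℕ, max a b ≤ i → F.betti i (i + 1) = 0

end K3Carpet

universe w'
namespace K3Carpet
open MvPolynomial TensorProduct

/-! ### Homogeneous vectors and homogeneous maps between graded free modules. -/

section GradedVectors

variable {R : Type*} [CommRing R] {σ : Type*}

/-! The homology of the `k`-th constant strand of a resolution of `P/I` is the degree `k` part of
Tor of `P/I` with the coefficient ring, so it does not depend on the resolution. This is proved by
hand: homogeneous comparison maps and a homogeneous homotopy (`exists_chainMap`,
`exists_nullHomotopy`) show that exactness of a strand at a positive spot passes from one resolution
to any other.

Over a field, the strands of a minimal resolution have zero differential, so exactness at spot `a`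
of strand `a + 1` means `β_{a,a+1} = 0`. This single vanishing gives all of Green's condition. The
carpet ideal has no elements of degree below 2, so the `i`-th term of the minimal resolution has no
generators of degree below `i + 1` for `i ≥ 1`. A generator of the next term in degree `i + 2` has a
nonzero differential whose nonzero entries have positive degree, so it needs a generator of degree
exactly `i + 1`. Once the linear strand stops, it stays zero.

To pass from `ℤ` to a field one needs the base change of a resolution to remain a resolution, which
follows from flatness of the coordinate ring over `ℤ` (`flat_carpet`). The carpet ideal is the
preimage of `((tu - sv)^2)` under the parametrization of the two rational normal curves
(`mem_carpetIdeal_iff`). Torsion-freeness is thereby reduced to the quotient of `ℤ[s,t,u,v]` by a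
polynomial with a coefficient equal to 1, which no prime number divides. -/

theorem HomogeneousOfDegree.coeff_eq_zero {p : MvPolynomial σ R} {n : ℤ}
    (h : HomogeneousOfDegree p n) {m : σ →₀ ℕ} (hm : ((m.degree : ℕ) : ℤ) ≠ n) :
    coeff m p = 0 := by
  by_contra hc
  exact hm (h m (mem_support_iff.2 hc))

theorem homogeneousOfDegree_zero (n : ℤ) : HomogeneousOfDegree (0 : MvPolynomial σ R) n := by
  intro m hm
  simp at hm

theorem HomogeneousOfDegree.add {p q : MvPolynomial σ R} {n : ℤ}
    (hp : HomogeneousOfDegree p n) (hq : HomogeneousOfDegree q n) :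
    HomogeneousOfDegree (p + q) n := by
  intro m hm
  by_contra hc
  rw [mem_support_iff, coeff_add, hp.coeff_eq_zero hc, hq.coeff_eq_zero hc, add_zero] at hm
  exact hm rfl

theorem HomogeneousOfDegree.neg {p : MvPolynomial σ R} {n : ℤ}
    (hp : HomogeneousOfDegree p n) : HomogeneousOfDegree (-p) n := by
  intro m hm
  rw [support_neg] at hm
  exact hp m hm

theorem HomogeneousOfDegree.sub {p q : MvPolynomial σ R} {n : ℤ}
    (hp : HomogeneousOfDegree p n) (hq : HomogeneousOfDegree q n) :
    HomogeneousOfDegree (p - q) n := by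
  rw [sub_eq_add_neg]
  exact hp.add hq.neg

theorem HomogeneousOfDegree.mul {p q : MvPolynomial σ R} {n k : ℤ}
    (hp : HomogeneousOfDegree p n) (hq : HomogeneousOfDegree q k) :
    HomogeneousOfDegree (p * q) (n + k) := by
  classical
  intro m hm
  obtain ⟨x, hx, y, hy, rfl⟩ := Finset.mem_add.1 (support_mul p q hm)
  rw [← hp x hx, ← hq y hy, map_add]
  push_cast
  rfl

theorem HomogeneousOfDegree.sum {α : Type*} (s : Finset α) {f : α → MvPolynomial σ R} {n : ℤ}
    (h : ∀ i ∈ s, HomogeneousOfDegree (f i) n) : HomogeneousOfDegree (∑ i ∈ s, f i) n := by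
  classical
  induction s using Finset.induction_on with
  | empty => simpa using homogeneousOfDegree_zero n
  | insert i s hi ih =>
    rw [Finset.sum_insert hi]
    exact (h i (by simp)).add (ih fun j hj => h j (by simp [hj]))

theorem homogeneousOfDegree_monomial (m : σ →₀ ℕ) (r : R) :
    HomogeneousOfDegree (monomial m r) ((m.degree : ℕ) : ℤ) := by
  intro x hx
  rw [Finset.mem_singleton.1 (support_monomial_subset hx)]

theorem homogeneousOfDegree_one : HomogeneousOfDegree (1 : MvPolynomial σ R) 0 := by
  simpa using homogeneousOfDegree_monomial (0 : σ →₀ ℕ) (1 : R)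

theorem homogeneousOfDegree_X (i : σ) : HomogeneousOfDegree (X i : MvPolynomial σ R) 1 := by
  simpa [X] using homogeneousOfDegree_monomial (Finsupp.single i 1) (1 : R)

/-- The homogeneous component of integer degree `k` of a polynomial. -/
noncomputable def intComponent (k : ℤ) (p : MvPolynomial σ R) : MvPolynomial σ R :=
  if 0 ≤ k then homogeneousComponent k.toNat p else 0

theorem coeff_intComponent (k : ℤ) (p : MvPolynomial σ R) (m : σ →₀ ℕ) :
    coeff m (intComponent k p) = if ((m.degree : ℕ) : ℤ) = k then coeff m p else 0 := by
  unfold intComponent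
  split_ifs with h1 h2 h2
  · rw [coeff_homogeneousComponent, if_pos (by omega)]
  · rw [coeff_homogeneousComponent, if_neg (by omega)]
  · omega
  · simp

theorem intComponent_add (k : ℤ) (p q : MvPolynomial σ R) :
    intComponent k (p + q) = intComponent k p + intComponent k q := by
  ext m
  simp only [coeff_add, coeff_intComponent]
  split_ifs <;> simp

theorem intComponent_zero (k : ℤ) : intComponent k (0 : MvPolynomial σ R) = 0 := by
  ext m
  simp [coeff_intComponent]

theorem homogeneousOfDegree_intComponent (k : ℤ) (p : MvPolynomial σ R) :
    HomogeneousOfDegree (intComponent k p) k := by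
  intro m hm
  by_contra hc
  simp [coeff_intComponent, hc] at hm

theorem HomogeneousOfDegree.intComponent_eq {p : MvPolynomial σ R} {n : ℤ}
    (h : HomogeneousOfDegree p n) (k : ℤ) : intComponent k p = if n = k then p else 0 := by
  ext m
  rw [coeff_intComponent]
  by_cases hm : ((m.degree : ℕ) : ℤ) = n
  · rw [hm]; split_ifs <;> simp
  · rw [h.coeff_eq_zero hm]; split_ifs <;> simp [h.coeff_eq_zero hm]

variable {ι κ : Type*}

/-- `v` is homogeneous of degree `k` in the graded free module whose basis element `l` has
degree `deg l`. -/
def HomVec (deg : ι → ℤ) (k : ℤ) (v : ι →₀ MvPolynomial σ R) : Prop :=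
  ∀ l, HomogeneousOfDegree (v l) (k - deg l)

theorem HomVec.add {deg : ι → ℤ} {k : ℤ} {v w : ι →₀ MvPolynomial σ R}
    (hv : HomVec deg k v) (hw : HomVec deg k w) : HomVec deg k (v + w) :=
  fun l => (hv l).add (hw l)

theorem HomVec.sub {deg : ι → ℤ} {k : ℤ} {v w : ι →₀ MvPolynomial σ R}
    (hv : HomVec deg k v) (hw : HomVec deg k w) : HomVec deg k (v - w) :=
  fun l => (hv l).sub (hw l)

theorem homVec_zero (deg : ι → ℤ) (k : ℤ) : HomVec deg k (0 : ι →₀ MvPolynomial σ R) :=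
  fun _ => homogeneousOfDegree_zero _

theorem homVec_single {deg : ι → ℤ} {k : ℤ} {l : ι} {p : MvPolynomial σ R}
    (hp : HomogeneousOfDegree p (k - deg l)) : HomVec deg k (Finsupp.single l p) := by
  classical
  intro x
  rw [Finsupp.single_apply]
  split_ifs with h
  · exact h ▸ hp
  · exact homogeneousOfDegree_zero _

/-- The homogeneous component of degree `k` of a vector. -/
noncomputable def vecComp (deg : ι → ℤ) (k : ℤ) (v : ι →₀ MvPolynomial σ R) :
    ι →₀ MvPolynomial σ R :=
  Finsupp.onFinset v.support (fun l => intComponent (k - deg l) (v l)) fun l hl => by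
    rw [Finsupp.mem_support_iff]
    intro h
    exact hl (by rw [h, intComponent_zero])

theorem vecComp_apply (deg : ι → ℤ) (k : ℤ) (v : ι →₀ MvPolynomial σ R) (l : ι) :
    vecComp deg k v l = intComponent (k - deg l) (v l) := rfl

theorem vecComp_add (deg : ι → ℤ) (k : ℤ) (v w : ι →₀ MvPolynomial σ R) :
    vecComp deg k (v + w) = vecComp deg k v + vecComp deg k w := by
  ext1 l
  simp [vecComp_apply, intComponent_add]

theorem vecComp_zero (deg : ι → ℤ) (k : ℤ) :
    vecComp deg k (0 : ι →₀ MvPolynomial σ R) = 0 := by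
  ext1 l
  simp [vecComp_apply, intComponent_zero]

theorem homVec_vecComp (deg : ι → ℤ) (k : ℤ) (v : ι →₀ MvPolynomial σ R) :
    HomVec deg k (vecComp deg k v) :=
  fun _ => homogeneousOfDegree_intComponent _ _

theorem HomVec.vecComp_eq {deg : ι → ℤ} {n : ℤ} {v : ι →₀ MvPolynomial σ R}
    (h : HomVec deg n v) (k : ℤ) : vecComp deg k v = if n = k then v else 0 := by
  ext1 l
  rw [vecComp_apply, (h l).intComponent_eq]
  by_cases hk : n = k
  · simp [hk]
  · rw [if_neg hk, if_neg (by omega), Finsupp.zero_apply]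

theorem HomVec.vecComp_self {deg : ι → ℤ} {n : ℤ} {v : ι →₀ MvPolynomial σ R}
    (h : HomVec deg n v) : vecComp deg n v = v := by
  rw [h.vecComp_eq, if_pos rfl]

/-- Induction on vectors: it is enough to treat homogeneous vectors and sums. -/
theorem homVec_induction (deg : ι → ℤ) {P : (ι →₀ MvPolynomial σ R) → Prop}
    (hom : ∀ k v, HomVec deg k v → P v) (add : ∀ v w, P v → P w → P (v + w))
    (v : ι →₀ MvPolynomial σ R) : P v := by
  induction v using Finsupp.induction_linear with
  | zero => exact hom 0 0 (homVec_zero _ _)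
  | add v w hv hw => exact add v w hv hw
  | single l p =>
    induction p using MvPolynomial.induction_on' with
    | monomial m r =>
      refine hom ((m.degree : ℕ) + deg l) _ (homVec_single ?_)
      rw [add_sub_cancel_right]
      exact homogeneousOfDegree_monomial m r
    | add p q hp hq =>
      rw [Finsupp.single_add]
      exact add _ _ hp hq

/-- A map of graded free modules is homogeneous of degree `0`. -/
def HomMap (degι : ι → ℤ) (degκ : κ → ℤ)
    (φ : (ι →₀ MvPolynomial σ R) →ₗ[MvPolynomial σ R] (κ →₀ MvPolynomial σ R)) : Prop :=
  ∀ m, HomVec degκ (degι m) (φ (Finsupp.single m 1))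

theorem linearMap_apply_eq_sum {S M : Type*} [CommRing S] [AddCommGroup M] [Module S M]
    (φ : (ι →₀ S) →ₗ[S] M) (v : ι →₀ S) :
    φ v = ∑ l ∈ v.support, v l • φ (Finsupp.single l 1) := by
  conv_lhs => rw [← Finsupp.sum_single v]
  rw [Finsupp.sum, map_sum]
  refine Finset.sum_congr rfl fun l _ => ?_
  rw [← map_smul, Finsupp.smul_single, smul_eq_mul, mul_one]

variable {degι : ι → ℤ} {degκ : κ → ℤ}
  {φ ψ : (ι →₀ MvPolynomial σ R) →ₗ[MvPolynomial σ R] (κ →₀ MvPolynomial σ R)}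

theorem HomMap.map_homVec (hφ : HomMap degι degκ φ) {k : ℤ} {v : ι →₀ MvPolynomial σ R}
    (hv : HomVec degι k v) : HomVec degκ k (φ v) := by
  intro x
  rw [linearMap_apply_eq_sum, Finsupp.finsetSum_apply]
  refine HomogeneousOfDegree.sum _ fun l _ => ?_
  have := (hv l).mul (hφ l x)
  rwa [sub_add_sub_cancel] at this

/-- This is what makes exactness graded: a preimage of a homogeneous vector can be replaced by its
component of the right degree. -/
theorem HomMap.map_vecComp (hφ : HomMap degι degκ φ) (k : ℤ) (v : ι →₀ MvPolynomial σ R) :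
    φ (vecComp degι k v) = vecComp degκ k (φ v) := by
  induction v using homVec_induction degι with
  | hom n v hv =>
    rw [hv.vecComp_eq, (hφ.map_homVec hv).vecComp_eq]
    split_ifs <;> simp
  | add v w hv hw => rw [vecComp_add, map_add, map_add, vecComp_add, hv, hw]

theorem HomMap.comp {μ : Type*} {degμ : μ → ℤ}
    {χ : (κ →₀ MvPolynomial σ R) →ₗ[MvPolynomial σ R] (μ →₀ MvPolynomial σ R)}
    (hχ : HomMap degκ degμ χ) (hφ : HomMap degι degκ φ) : HomMap degι degμ (χ ∘ₗ φ) :=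
  fun m => hχ.map_homVec (hφ m)

theorem HomMap.sub (hφ : HomMap degι degκ φ) (hψ : HomMap degι degκ ψ) :
    HomMap degι degκ (φ - ψ) :=
  fun m => (hφ m).sub (hψ m)

theorem homMap_id : HomMap degι degι
    (LinearMap.id : (ι →₀ MvPolynomial σ R) →ₗ[MvPolynomial σ R] _) := fun m =>
  homVec_single (by simpa using homogeneousOfDegree_one)

/-- Homogeneous maps out of a graded free module lift along maps that are onto in each degree. -/
theorem exists_homMap_lift {M : Type*} [AddCommGroup M] [Module (MvPolynomial σ R) M]
    (π : (κ →₀ MvPolynomial σ R) →ₗ[MvPolynomial σ R] M)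
    (θ : (ι →₀ MvPolynomial σ R) →ₗ[MvPolynomial σ R] M)
    (h : ∀ m, ∃ w, HomVec degκ (degι m) w ∧ π w = θ (Finsupp.single m 1)) :
    ∃ χ, HomMap degι degκ χ ∧ π ∘ₗ χ = θ := by
  choose w hw hπ using h
  refine ⟨Finsupp.linearCombination _ w, fun m => ?_, ?_⟩
  · simpa using hw m
  · ext m
    simpa using hπ m

end GradedVectors

/-- Dependent choice with an invariant `P` that guarantees the next choice. Chain maps and
homotopies are both built this way. -/
theorem exists_dependent_seq {X : ℕ → Type*} (P : ∀ i, X i → Prop)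
    (Q : ∀ i, X i → X (i + 1) → Prop) (h0 : ∃ x, P 0 x)
    (hs : ∀ i x, P i x → ∃ y, P (i + 1) y ∧ Q i x y) :
    ∃ f : ∀ i, X i, P 0 (f 0) ∧ ∀ i, P (i + 1) (f (i + 1)) ∧ Q i (f i) (f (i + 1)) := by
  choose y hy using hs
  obtain ⟨x0, hx0⟩ := h0
  let f : ∀ i, {x : X i // P i x} := fun i =>
    Nat.rec ⟨x0, hx0⟩ (fun i x => ⟨y i x.1 x.2, (hy i x.1 x.2).1⟩) i
  exact ⟨fun i => (f i).1, hx0, fun i => ⟨(f (i + 1)).2, (hy i (f i).1 (f i).2).2⟩⟩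

/-! ### Constant strands and the maps induced on them. -/

section Strand

variable {R : Type*} [CommRing R] {σ : Type*} {ι κ μ : Type*}

/-- The degree `k` part of the vector of constant terms. -/
noncomputable def strandVec (deg : ι → ℤ) (k : ℤ) (v : ι →₀ MvPolynomial σ R) :
    {l : ι // deg l = k} →₀ R :=
  (v.mapRange constantCoeff (map_zero _)).subtypeDomain fun l => deg l = k

@[simp]
theorem strandVec_apply (deg : ι → ℤ) (k : ℤ) (v : ι →₀ MvPolynomial σ R)
    (l : {l : ι // deg l = k}) : strandVec deg k v l = constantCoeff (v l) := rfl

@[simp]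
theorem strandVec_zero (deg : ι → ℤ) (k : ℤ) :
    strandVec deg k (0 : ι →₀ MvPolynomial σ R) = 0 := by
  ext
  simp

theorem strandVec_add (deg : ι → ℤ) (k : ℤ) (v w : ι →₀ MvPolynomial σ R) :
    strandVec deg k (v + w) = strandVec deg k v + strandVec deg k w := by
  ext
  simp

/-- The map of `k`-th constant strands induced by a map of graded free modules. -/
noncomputable def strandMap (degι : ι → ℤ) (degκ : κ → ℤ) (k : ℤ)
    (φ : (ι →₀ MvPolynomial σ R) →ₗ[MvPolynomial σ R] (κ →₀ MvPolynomial σ R)) :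
    ({l : ι // degι l = k} →₀ R) →ₗ[R] ({l : κ // degκ l = k} →₀ R) :=
  Finsupp.linearCombination R fun m => strandVec degκ k (φ (Finsupp.single m.1 1))

variable {degι : ι → ℤ} {degκ : κ → ℤ} {degμ : μ → ℤ}
  {φ ψ : (ι →₀ MvPolynomial σ R) →ₗ[MvPolynomial σ R] (κ →₀ MvPolynomial σ R)}

/-- An entry of a homogeneous map between basis elements of different degrees has nonzero degree,
hence no constant term. Reducing modulo the variables therefore respects the decomposition by
degree, which makes strands functorial. -/
theorem HomMap.strandVec_map (hφ : HomMap degι degκ φ) (k : ℤ) (v : ι →₀ MvPolynomial σ R) :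
    strandVec degκ k (φ v) = strandMap degι degκ k φ (strandVec degι k v) := by
  induction v using Finsupp.induction_linear with
  | zero =>
    rw [map_zero, strandVec_zero, strandVec_zero, map_zero]
  | add v w hv hw =>
    rw [map_add, strandVec_add, strandVec_add, map_add, hv, hw]
  | single l p =>
    have h1 : φ (Finsupp.single l p) = p • φ (Finsupp.single l 1) := by
      rw [← map_smul, Finsupp.smul_single, smul_eq_mul, mul_one]
    by_cases hl : degι l = k
    · have h2 : strandVec degι k (Finsupp.single l p)
          = Finsupp.single ⟨l, hl⟩ (constantCoeff p) := by
        classical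
        ext x
        rw [strandVec_apply, Finsupp.single_apply, Finsupp.single_apply]
        simp only [Subtype.ext_iff]
        split_ifs <;> simp
      rw [h1, h2, strandMap, Finsupp.linearCombination_single]
      ext x
      simp
    · have h2 : strandVec degι k (Finsupp.single l p) = 0 := by
        classical
        ext x
        rw [strandVec_apply, Finsupp.single_apply, if_neg (by rintro rfl; exact hl x.2)]
        simp
      rw [h1, h2, map_zero]
      ext x
      have h3 : constantCoeff (φ (Finsupp.single l 1) x.1) = 0 :=
        (hφ l x.1).coeff_eq_zero (by have := x.2; simp; omega)
      simp [h3]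

theorem strandMap_comp
    {χ : (κ →₀ MvPolynomial σ R) →ₗ[MvPolynomial σ R] (μ →₀ MvPolynomial σ R)}
    (hχ : HomMap degκ degμ χ) (k : ℤ) :
    strandMap degι degμ k (χ ∘ₗ φ) = strandMap degκ degμ k χ ∘ₗ strandMap degι degκ k φ := by
  refine Finsupp.lhom_ext' fun m => LinearMap.ext_ring ?_
  have h (v) : strandMap degκ degμ k χ (strandVec degκ k v) = strandVec degμ k (χ v) :=
    (hχ.strandVec_map k v).symm
  simp only [LinearMap.comp_apply, Finsupp.lsingle_apply, strandMap,
    Finsupp.linearCombination_single, one_smul]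
  exact (h _).symm

theorem strandMap_zero (k : ℤ) : strandMap degι degκ k
    (0 : (ι →₀ MvPolynomial σ R) →ₗ[MvPolynomial σ R] (κ →₀ MvPolynomial σ R)) = 0 := by
  ext m x
  simp [strandMap]

theorem strandMap_sub (k : ℤ) :
    strandMap degι degκ k (φ - ψ) = strandMap degι degκ k φ - strandMap degι degκ k ψ := by
  ext m x
  simp [strandMap]

theorem strandMap_id (k : ℤ) :
    strandMap degι degι k (LinearMap.id : (ι →₀ MvPolynomial σ R) →ₗ[MvPolynomial σ R] _) =
      LinearMap.id := by
  classical
  ext m x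
  simp only [strandMap, LinearMap.id_coe, id_eq, LinearMap.coe_comp, Function.comp_apply,
    Finsupp.lsingle_apply, Finsupp.linearCombination_single, one_smul, strandVec_apply,
    Finsupp.single_apply, Subtype.ext_iff]
  split_ifs <;> simp

end Strand

/-- The ideal `I` contains the homogeneous components of its elements. -/
def ClosedUnderComponents {R : Type*} [CommRing R] {σ : Type*} (I : Ideal (MvPolynomial σ R)) :
    Prop :=
  ∀ p ∈ I, ∀ k : ℤ, intComponent k p ∈ I

/-! ### Comparison of resolutions. -/

namespace GradedFreeResolution

variable {R : Type u} [CommRing R] {σ : Type v} {I : Ideal (MvPolynomial σ R)}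

theorem d_homMap (F : GradedFreeResolution.{w} I) (i : ℕ) :
    HomMap (F.deg (i + 1)) (F.deg i) (F.d i) :=
  F.d_homogeneous i

theorem d_comp_d (F : GradedFreeResolution.{w} I) (i : ℕ) : F.d i ∘ₗ F.d (i + 1) = 0 := by
  ext1 m
  exact LinearMap.ext fun x => (F.exact_succ i).apply_apply_eq_zero _

theorem constantStrandD_eq (F : GradedFreeResolution.{w} I) (k : ℤ) (i : ℕ) :
    F.constantStrandD k i = strandMap (F.deg (i + 1)) (F.deg i) k (F.d i) := rfl

/-- The augmentation lifts to a homogeneous map to `P`. -/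
theorem exists_augmentation_lift (F : GradedFreeResolution.{w} I) :
    ∃ q : (F.ι 0 →₀ MvPolynomial σ R) →ₗ[MvPolynomial σ R] (Unit →₀ MvPolynomial σ R),
      HomMap (F.deg 0) (fun _ => 0) q ∧ ∀ v, F.ε v = Ideal.Quotient.mk I (q v ()) := by
  choose p hp hε using F.ε_homogeneous
  refine ⟨Finsupp.linearCombination _ fun l => Finsupp.single () (p l), fun m => ?_, fun v => ?_⟩
  · rw [Finsupp.linearCombination_single, one_smul]
    exact homVec_single (by simpa using hp m)
  · rw [linearMap_apply_eq_sum, linearMap_apply_eq_sum, Finsupp.finsetSum_apply, map_sum]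
    refine Finset.sum_congr rfl fun l _ => ?_
    rw [hε, Finsupp.linearCombination_single, one_smul, Finsupp.smul_apply,
      Finsupp.single_eq_same, smul_eq_mul, map_mul]
    rfl

/-- Any preimage may be replaced by its component of degree `k`: the error in the lift to `P` lies
in `I`, and so does the component of that error. -/
theorem exists_homVec_ε (hI : ClosedUnderComponents I) (F : GradedFreeResolution.{w} I) {k : ℤ}
    {p : MvPolynomial σ R} (hp : HomogeneousOfDegree p k) :
    ∃ x, HomVec (F.deg 0) k x ∧ F.ε x = Ideal.Quotient.mk I p := by
  obtain ⟨q, hq, hε⟩ := F.exists_augmentation_lift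
  obtain ⟨x, hx⟩ := F.ε_surjective (Ideal.Quotient.mk I p)
  refine ⟨vecComp (F.deg 0) k x, homVec_vecComp _ _ _, ?_⟩
  rw [hε, Ideal.Quotient.mk_eq_mk_iff_sub_mem] at hx
  rw [hε, Ideal.Quotient.mk_eq_mk_iff_sub_mem, hq.map_vecComp, vecComp_apply]
  have h := hI _ hx k
  have h2 : intComponent k (q x ()) = intComponent k (q x () - p) + p := by
    conv_lhs => rw [← sub_add_cancel (q x ()) p, intComponent_add]
    rw [hp.intComponent_eq, if_pos rfl]
  rwa [sub_zero, h2, add_sub_cancel_right]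

theorem exists_homVec_d_zero (F : GradedFreeResolution.{w} I) {k : ℤ}
    {y : F.ι 0 →₀ MvPolynomial σ R} (hy : HomVec (F.deg 0) k y) (h0 : F.ε y = 0) :
    ∃ x, HomVec (F.deg 1) k x ∧ F.d 0 x = y := by
  obtain ⟨x, rfl⟩ := (F.exact_zero y).1 h0
  exact ⟨vecComp _ k x, homVec_vecComp _ _ _,
    by rw [(F.d_homMap 0).map_vecComp, hy.vecComp_self]⟩

theorem exists_homVec_d_succ (F : GradedFreeResolution.{w} I) (i : ℕ) {k : ℤ}
    {y : F.ι (i + 1) →₀ MvPolynomial σ R} (hy : HomVec (F.deg (i + 1)) k y) (h0 : F.d i y = 0) :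
    ∃ x, HomVec (F.deg (i + 2)) k x ∧ F.d (i + 1) x = y := by
  obtain ⟨x, rfl⟩ := (F.exact_succ i y).1 h0
  exact ⟨vecComp _ k x, homVec_vecComp _ _ _,
    by rw [(F.d_homMap (i + 1)).map_vecComp, hy.vecComp_self]⟩

/-- There is a homogeneous map of resolutions over the identity of `P/I`. -/
theorem exists_chainMap (hI : ClosedUnderComponents I) (F : GradedFreeResolution.{w} I)
    (G : GradedFreeResolution.{w'} I) :
    ∃ f : ∀ i, (F.ι i →₀ MvPolynomial σ R) →ₗ[MvPolynomial σ R] (G.ι i →₀ MvPolynomial σ R),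
      (∀ i, HomMap (F.deg i) (G.deg i) (f i)) ∧ G.ε ∘ₗ f 0 = F.ε ∧
      ∀ i, G.d i ∘ₗ f (i + 1) = f i ∘ₗ F.d i := by
  obtain ⟨f, hf0, hf⟩ := exists_dependent_seq
    (X := fun i => (F.ι i →₀ MvPolynomial σ R) →ₗ[MvPolynomial σ R] (G.ι i →₀ MvPolynomial σ R))
    -- The last clause says that `f` sends boundaries to boundaries, which is exactly what is needed
    -- to lift once more. Compatibility with the augmentation is demanded only at index 0.
    (fun i f => HomMap (F.deg i) (G.deg i) f ∧ (∀ h : i = 0, by subst h; exact G.ε ∘ₗ f = F.ε) ∧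
      ∀ x, ∃ y, G.d i y = f (F.d i x))
    (fun i f g => G.d i ∘ₗ g = f ∘ₗ F.d i) (by
      obtain ⟨f, hf, hε⟩ := exists_homMap_lift (degι := F.deg 0) (degκ := G.deg 0) G.ε F.ε (by
        intro m
        obtain ⟨p, hp, hε⟩ := F.ε_homogeneous m
        rw [hε]
        exact exists_homVec_ε hI G hp)
      refine ⟨f, hf, fun _ => hε, fun x => (G.exact_zero _).1 ?_⟩
      rw [← LinearMap.comp_apply, hε]
      exact F.exact_zero.apply_apply_eq_zero x) (by
      rintro i f ⟨hf, -, hr⟩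
      obtain ⟨g, hg, hc⟩ := exists_homMap_lift (degι := F.deg (i + 1)) (degκ := G.deg (i + 1))
        (G.d i) (f ∘ₗ F.d i) (by
          intro m
          obtain ⟨y, hy⟩ := hr (Finsupp.single m 1)
          have hh := (hf.comp (F.d_homMap i)) m
          refine ⟨vecComp _ (F.deg (i + 1) m) y, homVec_vecComp _ _ _, ?_⟩
          rw [(G.d_homMap i).map_vecComp, hy]
          exact hh.vecComp_self)
      refine ⟨g, ⟨hg, fun h => absurd h (by omega), fun x => (G.exact_succ i _).1 ?_⟩, hc⟩
      rw [← LinearMap.comp_apply, hc, LinearMap.comp_apply,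
        (F.exact_succ i).apply_apply_eq_zero x, map_zero])
  refine ⟨f, fun i => ?_, hf0.2.1 rfl, fun i => (hf i).2⟩
  cases i with
  | zero => exact hf0.1
  | succ i => exact (hf i).1.1

/-- A homogeneous endomorphism of a resolution over the zero map is null-homotopic, by a
homogeneous homotopy. -/
theorem exists_nullHomotopy (G : GradedFreeResolution.{w} I)
    (φ : ∀ i, (G.ι i →₀ MvPolynomial σ R) →ₗ[MvPolynomial σ R] (G.ι i →₀ MvPolynomial σ R))
    (hφ : ∀ i, HomMap (G.deg i) (G.deg i) (φ i)) (hε : G.ε ∘ₗ φ 0 = 0)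
    (hd : ∀ i, G.d i ∘ₗ φ (i + 1) = φ i ∘ₗ G.d i) :
    ∃ h : ∀ i, (G.ι i →₀ MvPolynomial σ R) →ₗ[MvPolynomial σ R] (G.ι (i + 1) →₀ MvPolynomial σ R),
      (∀ i, HomMap (G.deg i) (G.deg (i + 1)) (h i)) ∧
      ∀ i, G.d (i + 1) ∘ₗ h (i + 1) = φ (i + 1) - h i ∘ₗ G.d i := by
  obtain ⟨f, hf0, hf⟩ := exists_dependent_seq
    (X := fun i => (G.ι i →₀ MvPolynomial σ R) →ₗ[MvPolynomial σ R]
      (G.ι (i + 1) →₀ MvPolynomial σ R))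
    -- The invariant says that the vectors to be lifted next are cycles. The identity at spot 0 is
    -- used only to start the recursion, since the conclusion concerns positive spots.
    (fun i h => HomMap (G.deg i) (G.deg (i + 1)) h ∧ G.d i ∘ₗ (φ (i + 1) - h ∘ₗ G.d i) = 0)
    (fun i h h' => G.d (i + 1) ∘ₗ h' = φ (i + 1) - h ∘ₗ G.d i) (by
      obtain ⟨h, hh, hc⟩ := exists_homMap_lift (degι := G.deg 0) (degκ := G.deg 1) (G.d 0) (φ 0)
        fun m => G.exists_homVec_d_zero (hφ 0 m) (LinearMap.congr_fun hε _)
      refine ⟨h, hh, ?_⟩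
      refine LinearMap.ext fun x => ?_
      have e1 := LinearMap.congr_fun (hd 0) x
      have e2 := LinearMap.congr_fun hc (G.d 0 x)
      simp only [LinearMap.comp_apply] at e1 e2
      simp only [LinearMap.comp_apply, LinearMap.sub_apply, LinearMap.zero_apply, map_sub]
      rw [e1, e2, sub_self]) (by
      rintro i h ⟨hh, hz⟩
      obtain ⟨h', hh', hc⟩ := exists_homMap_lift (degι := G.deg (i + 1)) (degκ := G.deg (i + 2))
        (G.d (i + 1)) (φ (i + 1) - h ∘ₗ G.d i) fun m => G.exists_homVec_d_succ i
          (((hφ (i + 1)).sub (hh.comp (G.d_homMap i))) m) (LinearMap.congr_fun hz _)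
      refine ⟨h', ⟨hh', ?_⟩, hc⟩
      refine LinearMap.ext fun x => ?_
      have e1 := LinearMap.congr_fun (hd (i + 1)) x
      have e2 := LinearMap.congr_fun hc (G.d (i + 1) x)
      have e3 := (G.exact_succ i).apply_apply_eq_zero x
      simp only [LinearMap.comp_apply, LinearMap.sub_apply, e3, map_zero, sub_zero] at e1 e2
      simp only [LinearMap.comp_apply, LinearMap.sub_apply, LinearMap.zero_apply, map_sub]
      rw [e1, e2, sub_self])
  refine ⟨f, fun i => ?_, fun i => (hf i).2⟩
  cases i with
  | zero => exact hf0.1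
  | succ i => exact (hf i).1.1

/-- Exactness of a constant strand at a positive spot does not depend on the resolution. -/
theorem constantStrand_exact_of_exact (hI : ClosedUnderComponents I)
    (F : GradedFreeResolution.{w} I) (G : GradedFreeResolution.{w'} I) (k : ℤ) (i : ℕ)
    (hF : Function.Exact (F.constantStrandD k (i + 1)) (F.constantStrandD k i)) :
    Function.Exact (G.constantStrandD k (i + 1)) (G.constantStrandD k i) := by
  obtain ⟨f, hf, hfε, hfd⟩ := exists_chainMap hI F G
  obtain ⟨g, hg, hgε, hgd⟩ := exists_chainMap hI G F
  -- The difference of the identity and the round trip `G → F → G` lies over the zero map of `P/I`.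
  obtain ⟨h, hh, hhd⟩ := G.exists_nullHomotopy (fun i => LinearMap.id - f i ∘ₗ g i)
    (fun i => homMap_id.sub ((hf i).comp (hg i)))
    (by rw [LinearMap.comp_sub, ← LinearMap.comp_assoc, hfε, hgε, LinearMap.comp_id, sub_self])
    (fun i => by
      rw [LinearMap.comp_sub, LinearMap.sub_comp, ← LinearMap.comp_assoc, hfd,
        LinearMap.comp_assoc, hgd, LinearMap.comp_assoc]
      rfl)
  intro z
  simp only [constantStrandD_eq] at hF ⊢
  constructor
  · intro hz
    have e1 := congrArg (strandMap (G.deg (i + 1)) (F.deg i) k) (hgd i)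
    rw [strandMap_comp (F.d_homMap i), strandMap_comp (hg i)] at e1
    have e2 := LinearMap.congr_fun e1 z
    simp only [LinearMap.comp_apply, hz, map_zero] at e2
    obtain ⟨w, hw⟩ := (hF _).1 e2
    have e3 := LinearMap.congr_fun (congrArg (strandMap (F.deg (i + 2)) (G.deg (i + 1)) k)
      (hfd (i + 1))) w
    rw [strandMap_comp (G.d_homMap (i + 1)), strandMap_comp (hf (i + 1))] at e3
    simp only [LinearMap.comp_apply, hw] at e3
    have e4 := LinearMap.congr_fun (congrArg (strandMap (G.deg (i + 1)) (G.deg (i + 1)) k)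
      (hhd i)) z
    rw [strandMap_comp (G.d_homMap (i + 1)), strandMap_sub, strandMap_sub, strandMap_id,
      strandMap_comp (hf (i + 1)), strandMap_comp (hh i)] at e4
    simp only [LinearMap.comp_apply, LinearMap.sub_apply, LinearMap.id_apply, hz, map_zero,
      sub_zero] at e4
    -- For a cycle `z` the homotopy gives `z - f g z = d (h z)`. The cycle `g z` equals `d w` by
    -- exactness for `F`, so `f g z = d (f w)`.
    refine ⟨strandMap _ _ k (h (i + 1)) z + strandMap _ _ k (f (i + 2)) w, ?_⟩
    rw [map_add, e3, e4, sub_add_cancel]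
  · rintro ⟨w, rfl⟩
    rw [← LinearMap.comp_apply, ← strandMap_comp (G.d_homMap i), G.d_comp_d, strandMap_zero,
      LinearMap.zero_apply]

end GradedFreeResolution

/-! ### Minimal homogeneous generators and existence of minimal resolutions. -/

section HomogeneousGenerators

variable {R : Type*} [CommRing R] {σ : Type*} {ι : Type*}

theorem exists_sum_vecComp (deg : ι → ℤ) (v : ι →₀ MvPolynomial σ R) :
    ∃ A : Finset ℤ, ∑ k ∈ A, vecComp deg k v = v := by
  classical
  -- Allowing every larger set of degrees lets the two sets in the additive step be replaced by
  -- their union.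
  suffices h : ∃ A : Finset ℤ, ∀ B, A ⊆ B → ∑ k ∈ B, vecComp deg k v = v by
    obtain ⟨A, hA⟩ := h
    exact ⟨A, hA A subset_rfl⟩
  induction v using homVec_induction deg with
  | hom n v hv =>
    refine ⟨{n}, fun B hB => ?_⟩
    simp only [hv.vecComp_eq]
    rw [Finset.sum_ite_eq, if_pos (hB (by simp))]
  | add v w hv hw =>
    obtain ⟨A, hA⟩ := hv
    obtain ⟨A', hA'⟩ := hw
    refine ⟨A ∪ A', fun B hB => ?_⟩
    simp only [vecComp_add, Finset.sum_add_distrib]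
    rw [hA B (Finset.union_subset_left hB), hA' B (Finset.union_subset_right hB)]

/-- A submodule of a graded free module that contains the components of its elements is generated
by finitely many homogeneous elements if it is finitely generated. -/
theorem exists_homogeneous_generators (deg : ι → ℤ)
    {N : Submodule (MvPolynomial σ R) (ι →₀ MvPolynomial σ R)}
    (hN : ∀ v ∈ N, ∀ k, vecComp deg k v ∈ N) (hfg : N.FG) :
    ∃ (n : ℕ) (g : Fin n → ι →₀ MvPolynomial σ R) (deg' : Fin n → ℤ),
      (∀ j, HomVec deg (deg' j) (g j)) ∧ Submodule.span _ (Set.range g) = N := by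
  classical
  set T : Set (ι →₀ MvPolynomial σ R) := {v | v ∈ N ∧ ∃ k, HomVec deg k v} with hT
  have hspan : Submodule.span (MvPolynomial σ R) T = N := by
    refine le_antisymm (Submodule.span_le.2 fun v hv => hv.1) fun v hv => ?_
    obtain ⟨A, hA⟩ := exists_sum_vecComp deg v
    rw [← hA]
    exact Submodule.sum_mem _ fun k _ =>
      Submodule.subset_span ⟨hN v hv k, k, homVec_vecComp deg k v⟩
  obtain ⟨s, hs, hs'⟩ := (Submodule.fg_span_iff_fg_span_finset_subset T).1 (hspan ▸ hfg)
  have hdeg : ∀ j, ∃ k, HomVec deg k ((s.equivFin.symm j : s) : ι →₀ MvPolynomial σ R) :=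
    fun j => (hs (s.equivFin.symm j).2).2
  choose deg' hdeg' using hdeg
  refine ⟨s.card, fun j => (s.equivFin.symm j : s), deg', hdeg', ?_⟩
  rw [← hspan, hs']
  congr 1
  ext x
  constructor
  · rintro ⟨j, rfl⟩
    exact (s.equivFin.symm j).2
  · intro hx
    exact ⟨s.equivFin ⟨x, hx⟩, by simp⟩

/-- A map from a graded free module onto a given submodule, with the least number of basis
elements: no vector of its kernel has an entry whose constant term is a unit. -/
theorem exists_minimal_cover (deg : ι → ℤ)
    {N : Submodule (MvPolynomial σ R) (ι →₀ MvPolynomial σ R)}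
    (hN : ∀ v ∈ N, ∀ k, vecComp deg k v ∈ N) (hfg : N.FG) :
    ∃ (n : ℕ) (deg' : ULift.{w} (Fin n) → ℤ)
      (d : (ULift.{w} (Fin n) →₀ MvPolynomial σ R) →ₗ[MvPolynomial σ R]
        (ι →₀ MvPolynomial σ R)),
      HomMap deg' deg d ∧ LinearMap.range d = N ∧
      ∀ v ∈ LinearMap.ker d, ∀ l, ¬ IsUnit (constantCoeff (v l)) := by
  classical
  have hex := exists_homogeneous_generators deg hN hfg
  obtain ⟨g, deg', hg, hspan⟩ := Nat.find_spec hex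
  have hmin := fun n => Nat.find_min' hex (m := n)
  generalize Nat.find hex = n at *
  have hd : HomMap (fun l => deg' l.down) deg
      (Finsupp.linearCombination (MvPolynomial σ R) fun l : ULift.{w} (Fin n) => g l.down) := by
    intro l
    rw [Finsupp.linearCombination_single, one_smul]
    exact hg l.down
  refine ⟨n, fun l => deg' l.down, _, hd, ?_, ?_⟩
  · rw [Finsupp.range_linearCombination, ← hspan]
    congr 1
    exact ULift.down_surjective.range_comp g
  · rintro v hv ⟨l⟩ hu
    obtain ⟨n, rfl⟩ : ∃ n', n = n' + 1 := ⟨n - 1, by have := l.2; omega⟩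
    -- In the component of degree `deg' l` of the relation, the `l`-th entry is exactly the constant
    -- term. If that is a unit, the relation expresses `g l` through the other generators, against
    -- the minimality of their number.
    have hw := hd.map_vecComp (deg' l) v
    rw [LinearMap.mem_ker.1 hv, vecComp_zero] at hw
    have hwl : vecComp (fun l => deg' l.down) (deg' l) v ⟨l⟩ = C (constantCoeff (v ⟨l⟩)) := by
      rw [vecComp_apply]
      simp [intComponent, homogeneousComponent_zero, constantCoeff_eq]
    generalize vecComp (fun l => deg' l.down) (deg' l) v = y at hw hwl
    rw [Finsupp.linearCombination_apply, Finsupp.sum_fintype _ _ (by simp),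
      Fintype.sum_equiv Equiv.ulift _ (fun j => y ⟨j⟩ • g j) (by rintro ⟨j⟩; rfl),
      Fin.sum_univ_succAbove _ l, hwl] at hw
    have hmem : g l ∈ Submodule.span (MvPolynomial σ R) (Set.range (g ∘ l.succAbove)) := by
      have h1 : (C (constantCoeff (v ⟨l⟩)) : MvPolynomial σ R) • g l ∈
          Submodule.span (MvPolynomial σ R) (Set.range (g ∘ l.succAbove)) := by
        rw [eq_neg_of_add_eq_zero_left hw]
        exact Submodule.neg_mem _ (Submodule.sum_mem _ fun j _ =>
          Submodule.smul_mem _ _ (Submodule.subset_span ⟨j, rfl⟩))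
      exact (Submodule.smul_mem_iff_of_isUnit _ (hu.map C)).1 h1
    have := hmin n ⟨g ∘ l.succAbove, deg' ∘ l.succAbove, fun j => hg _, by
      rw [← hspan]
      refine le_antisymm (Submodule.span_mono (Set.range_comp_subset_range _ _))
        (Submodule.span_le.2 ?_)
      rintro _ ⟨j, rfl⟩
      rcases Fin.eq_self_or_eq_succAbove l j with rfl | ⟨j, rfl⟩
      · exact hmem
      · exact Submodule.subset_span ⟨j, rfl⟩⟩
    omega

end HomogeneousGenerators

/-- A graded free module with a homogeneous submodule, to be covered by the next term of a
resolution. -/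
structure ResolutionStage (R : Type u) [CommRing R] (σ : Type v) where
  /-- the index set of the basis -/
  ι : Type w
  /-- the index set is finite -/
  fin : Finite ι
  /-- the degrees of the basis elements -/
  deg : ι → ℤ
  /-- the submodule -/
  N : Submodule (MvPolynomial σ R) (ι →₀ MvPolynomial σ R)
  vecComp_mem : ∀ v ∈ N, ∀ k, vecComp deg k v ∈ N

namespace ResolutionStage

variable {R : Type u} [CommRing R] [IsNoetherianRing R] {σ : Type v} [Finite σ]

theorem exists_next (s : ResolutionStage.{w} R σ) :
    ∃ (t : ResolutionStage.{w} R σ)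
      (d : (t.ι →₀ MvPolynomial σ R) →ₗ[MvPolynomial σ R] (s.ι →₀ MvPolynomial σ R)),
      HomMap t.deg s.deg d ∧ LinearMap.range d = s.N ∧ LinearMap.ker d = t.N ∧
      ∀ v ∈ t.N, ∀ l, ¬ IsUnit (constantCoeff (v l)) := by
  have := s.fin
  obtain ⟨n, deg', d, hd, hr, hk⟩ :=
    exists_minimal_cover.{w} s.deg s.vecComp_mem (IsNoetherian.noetherian s.N)
  refine ⟨⟨ULift.{w} (Fin n), inferInstance, deg', LinearMap.ker d, fun v hv k => ?_⟩,
    d, hd, hr, rfl, hk⟩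
  rw [LinearMap.mem_ker, hd.map_vecComp, LinearMap.mem_ker.1 hv, vecComp_zero]

/-- The next stage of the construction of a minimal resolution. -/
noncomputable def next (s : ResolutionStage.{w} R σ) : ResolutionStage.{w} R σ :=
  s.exists_next.choose

/-- The cover of the submodule of `s` by the next stage. -/
noncomputable def cover (s : ResolutionStage.{w} R σ) :
    (s.next.ι →₀ MvPolynomial σ R) →ₗ[MvPolynomial σ R] (s.ι →₀ MvPolynomial σ R) :=
  s.exists_next.choose_spec.choose

theorem cover_spec (s : ResolutionStage.{w} R σ) :
    HomMap s.next.deg s.deg s.cover ∧ LinearMap.range s.cover = s.N ∧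
      LinearMap.ker s.cover = s.next.N ∧
      ∀ v ∈ s.next.N, ∀ l, ¬ IsUnit (constantCoeff (v l)) :=
  s.exists_next.choose_spec.choose_spec

theorem exact_cover (s : ResolutionStage.{w} R σ) {M : Type*} [AddCommGroup M]
    [Module (MvPolynomial σ R) M] (π : (s.ι →₀ MvPolynomial σ R) →ₗ[MvPolynomial σ R] M)
    (h : LinearMap.ker π = s.N) : Function.Exact s.cover π := by
  rw [LinearMap.exact_iff, h]
  exact s.cover_spec.2.1.symm

/-- The stage that consists of the submodule `I` of `P`. -/
noncomputable def initial (I : Ideal (MvPolynomial σ R)) (hI : ClosedUnderComponents I) :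
    ResolutionStage.{w} R σ :=
  ⟨PUnit.{w + 1}, inferInstance, fun _ => 0,
    LinearMap.ker (I.mkQ ∘ₗ Finsupp.lapply (PUnit.unit : PUnit.{w + 1})), fun v hv k => by
      rw [LinearMap.ker_comp, Submodule.ker_mkQ] at hv ⊢
      have := hI _ hv k
      simpa [vecComp_apply] using this⟩

omit [IsNoetherianRing R] [Finite σ] in
theorem mem_of_mem_initial {I : Ideal (MvPolynomial σ R)} {hI : ClosedUnderComponents I}
    {v : (initial.{w} I hI).ι →₀ MvPolynomial σ R} (hv : v ∈ (initial.{w} I hI).N)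
    (l : (initial.{w} I hI).ι) : v l ∈ I :=
  (Submodule.Quotient.mk_eq_zero I).1 hv

/-- The sequence of stages that starts with the submodule `I` of `P`. -/
noncomputable def seq (I : Ideal (MvPolynomial σ R)) (hI : ClosedUnderComponents I) :
    ℕ → ResolutionStage.{w} R σ
  | 0 => initial I hI
  | i + 1 => (seq I hI i).next

end ResolutionStage

namespace GradedFreeResolution

variable {R : Type u} [CommRing R] [IsNoetherianRing R] {σ : Type v} [Finite σ]

/-- A homogeneous ideal has a graded free resolution whose first term is `P` and none of whose
differentials has an entry with a unit as constant term. -/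
theorem exists_minimal (I : Ideal (MvPolynomial σ R)) (hI : ClosedUnderComponents I)
    (hI1 : I ≠ ⊤) :
    ∃ F : GradedFreeResolution.{w} I, (∀ l, F.deg 0 l = 0) ∧
      (∀ v l, F.ε v = 0 → v l ∈ I) ∧
      ∀ i (m : F.ι (i + 1)) (l : F.ι i),
        ¬ IsUnit (constantCoeff (F.d i (Finsupp.single m 1) l)) := by
  let s := ResolutionStage.seq.{w} I hI
  have hs : ∀ v : PUnit.{w + 1} →₀ MvPolynomial σ R, ∀ l, v ∈ (s 0).N → v l ∈ I :=
    fun v l hv => ResolutionStage.mem_of_mem_initial (hI := hI) hv l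
  let ε : (PUnit.{w + 1} →₀ MvPolynomial σ R) →ₗ[MvPolynomial σ R] (MvPolynomial σ R ⧸ I) :=
    I.mkQ ∘ₗ Finsupp.lapply PUnit.unit
  have hε (p : MvPolynomial σ R) : ε (Finsupp.single PUnit.unit p) = Ideal.Quotient.mk I p :=
    congrArg (Ideal.Quotient.mk I) Finsupp.single_eq_same
  let F : GradedFreeResolution.{w} I :=
    { ι := fun i => (s i).ι
      deg := fun i => (s i).deg
      d := fun i => (s i).cover
      ε := ε
      d_homogeneous := fun i => (s i).cover_spec.1
      ε_homogeneous := fun _ => ⟨1, homogeneousOfDegree_one, hε 1⟩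
      ε_surjective := I.mkQ_surjective.comp fun p =>
        ⟨Finsupp.single PUnit.unit p, Finsupp.single_eq_same⟩
      exact_zero := (s 0).exact_cover ε rfl
      exact_succ := fun i => (s (i + 1)).exact_cover (s i).cover (s i).cover_spec.2.2.1 }
  refine ⟨F, fun _ => rfl, fun v l hv => hs v l hv, fun i m l => ?_⟩
  have hmem : (s i).cover (Finsupp.single m 1) ∈ (s i).N := by
    rw [← (s i).cover_spec.2.1]
    exact ⟨_, rfl⟩
  cases i with
  | succ i => exact (s i).cover_spec.2.2.2 _ hmem l
  | zero =>
    -- Entries of the first differential lie in `I`, and so do their components of degree 0. A unit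
    -- among these would force `I = ⊤`.
    intro hu
    have h1 := hI _ (hs _ l hmem) 0
    refine hI1 (I.eq_top_of_isUnit_mem h1 ?_)
    have h2 := hu.map (C : R →+* MvPolynomial σ R)
    simp only [constantCoeff_eq] at h2
    simp only [intComponent, le_refl, if_true, Int.toNat_zero, homogeneousComponent_zero]
    exact h2

end GradedFreeResolution

/-! ### Normal forms for monomials on a rational normal curve. -/

section RationalNormalCurve

variable {B : Type*} [CommRing B] (a : ℕ) (x : ℕ → B)

/-- The standard product of `m` elements among `x_0, …, x_a` whose indices have sum `s`. -/
def normalProduct (m s : ℕ) : B :=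
  -- The general formula breaks down at the top index sum: truncated subtraction would leave a
  -- superfluous factor `x 0`.
  if s = a * m then x a ^ m else x a ^ (s / a) * x (s % a) * x 0 ^ (m - s / a - 1)

variable {a x}

theorem normalProduct_top (m : ℕ) : normalProduct a x m (a * m) = x a ^ m := by
  simp [normalProduct]

theorem normalProduct_of_lt {m q r : ℕ} (hq : q < m) (hr : r < a) :
    normalProduct a x m (a * q + r) = x a ^ q * x r * x 0 ^ (m - q - 1) := by
  have h : a * q + r ≠ a * m := by
    have : a * (q + 1) ≤ a * m := Nat.mul_le_mul_left a hq
    rw [mul_add, mul_one] at this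
    omega
  rw [normalProduct, if_neg h, Nat.mul_add_div (by omega), Nat.div_eq_of_lt hr, add_zero,
    Nat.mul_add_mod, Nat.mod_eq_of_lt hr]

/-- Division with a carry: with `r = s % a`, the product `x_i x_r` becomes `x_{i+r} x_0` if `i + r <
a` and `x_a x_{i+r-a}` otherwise. By iteration, a monomial depends only on its degree and its index
sum. -/
theorem mul_normalProduct (hx : ∀ i j k l, i ≤ a → j ≤ a → k ≤ a → l ≤ a → i + j = k + l →
    x i * x j = x k * x l) (ha : 1 ≤ a) {m s i : ℕ} (hs : s ≤ a * m) (hi : i ≤ a) :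
    x i * normalProduct a x m s = normalProduct a x (m + 1) (s + i) := by
  rcases hs.eq_or_lt with rfl | hs
  · rw [normalProduct_top]
    rcases hi.eq_or_lt with rfl | hi
    · rw [← mul_add_one, normalProduct_top, pow_succ']
    · rw [normalProduct_of_lt (by omega) hi, Nat.add_sub_cancel_left, Nat.sub_self, pow_zero]
      ring
  · have hr : s % a < a := Nat.mod_lt _ ha
    have hq : s / a < m := Nat.div_lt_of_lt_mul hs
    obtain ⟨q, r, hq', hr', rfl⟩ : ∃ q r, q < m ∧ r < a ∧ s = a * q + r :=
      ⟨_, _, hq, hr, (Nat.div_add_mod s a).symm⟩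
    rw [normalProduct_of_lt hq' hr']
    obtain ⟨n, rfl⟩ : ∃ n, m = q + n + 1 := ⟨m - q - 1, by omega⟩
    have e1 : q + n + 1 - q - 1 = n := by omega
    by_cases h : i + r < a
    · rw [show a * q + r + i = a * q + (i + r) by omega, normalProduct_of_lt (by omega) h, e1]
      have e2 : q + n + 1 + 1 - q - 1 = n + 1 := by omega
      have e3 := hx i r (i + r) 0 (by omega) (by omega) (by omega) (by omega) (by omega)
      rw [e2, pow_succ]
      linear_combination (x a ^ q * x 0 ^ n) * e3
    · obtain ⟨t, ht⟩ : ∃ t, i + r = a + t := ⟨i + r - a, by omega⟩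
      have e4 : a * q + r + i = a * (q + 1) + t := by rw [mul_add, mul_one]; omega
      rw [e4, normalProduct_of_lt (by omega) (by omega), e1]
      have e2 : q + n + 1 + 1 - (q + 1) - 1 = n := by omega
      have e3 := hx i r a t (by omega) (by omega) (by omega) (by omega) (by omega)
      rw [e2, pow_succ]
      linear_combination (x a ^ q * x 0 ^ n) * e3

/-- A minor moves one unit of index from one factor to the other. Repeating this `t` times gives
every quadratic relation. -/
theorem mul_eq_mul_of_minors (hx : ∀ i j, i < a → j < a → x i * x (j + 1) = x (i + 1) * x j) :
    ∀ i j k l, i ≤ a → j ≤ a → k ≤ a → l ≤ a → i + j = k + l → x i * x j = x k * x l := by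
  have key : ∀ t i j, i + t ≤ a → j + t ≤ a → x i * x (j + t) = x (i + t) * x j := by
    intro t
    induction t with
    | zero => intros; simp
    | succ t ih =>
      intro i j hi hj
      rw [← add_assoc, hx i (j + t) (by omega) (by omega), ih (i + 1) j (by omega) (by omega),
        show i + 1 + t = i + (t + 1) by omega]
  intro i j k l hi hj hk hl h
  rcases le_total i k with hik | hik
  · obtain ⟨t, rfl⟩ := Nat.exists_eq_add_of_le hik
    rw [show j = l + t by omega]
    exact key t i l (by omega) (by omega)
  · obtain ⟨t, rfl⟩ := Nat.exists_eq_add_of_le hik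
    rw [show l = j + t by omega]
    exact (key t k j (by omega) (by omega)).symm

end RationalNormalCurve

/-! ### The carpet generators under the monomial parametrization. -/

section Toric

variable (R : Type*) [CommRing R] (a b : ℕ)

/-- The parametrization `x_i ↦ s^{a-i} t^i`, `y_j ↦ u^{b-j} v^j` by `R[s, t, u, v]`. -/
noncomputable def toricMap : CoordPoly R a b →ₐ[R] MvPolynomial (Fin 4) R :=
  aeval (Sum.elim (fun i => X 0 ^ (a - (i : ℕ)) * X 1 ^ (i : ℕ))
    (fun j => X 2 ^ (b - (j : ℕ)) * X 3 ^ (j : ℕ)))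

/-- The form `(tu - sv)^2`, whose zero set is a double structure on the diagonal. -/
noncomputable def doubleDiagonal : MvPolynomial (Fin 4) R := (X 1 * X 2 - X 0 * X 3) ^ 2

variable {R a b}

@[simp]
theorem toricMap_inl (i : Fin (a + 1)) :
    toricMap R a b (X (Sum.inl i)) = X 0 ^ (a - (i : ℕ)) * X 1 ^ (i : ℕ) := by
  simp [toricMap]

@[simp]
theorem toricMap_inr (j : Fin (b + 1)) :
    toricMap R a b (X (Sum.inr j)) = X 2 ^ (b - (j : ℕ)) * X 3 ^ (j : ℕ) := by
  simp [toricMap]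

theorem toricMap_bilinear {i j : ℕ} (hi : i + 2 ≤ a) (hj : j + 2 ≤ b) :
    toricMap R a b (X (Sum.inl ⟨i + 2, by omega⟩) * X (Sum.inr ⟨j, by omega⟩)
      - 2 * X (Sum.inl ⟨i + 1, by omega⟩) * X (Sum.inr ⟨j + 1, by omega⟩)
      + X (Sum.inl ⟨i, by omega⟩) * X (Sum.inr ⟨j + 2, by omega⟩)) =
    X 0 ^ (a - 2 - i) * X 1 ^ i * (X 2 ^ (b - 2 - j) * X 3 ^ j) * doubleDiagonal R := by
  obtain ⟨n, rfl⟩ := Nat.exists_eq_add_of_le hi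
  obtain ⟨m, rfl⟩ := Nat.exists_eq_add_of_le hj
  simp only [map_add, map_sub, map_mul, map_ofNat, toricMap_inl, toricMap_inr, doubleDiagonal]
  rw [show i + 2 + n - (i + 2) = n by omega, show i + 2 + n - (i + 1) = n + 1 by omega,
    show i + 2 + n - i = n + 2 by omega, show j + 2 + m - (j + 2) = m by omega,
    show j + 2 + m - (j + 1) = m + 1 by omega, show j + 2 + m - j = m + 2 by omega,
    show i + 2 + n - 2 - i = n by omega, show j + 2 + m - 2 - j = m by omega]
  ring

theorem toricMap_cubic {i : ℕ} (hi : i + 2 ≤ a) (hb : b = 1) :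
    toricMap R a b (X (Sum.inl ⟨i + 2, by omega⟩) * X (Sum.inr ⟨0, by omega⟩) ^ 2
      - 2 * X (Sum.inl ⟨i + 1, by omega⟩) * X (Sum.inr ⟨0, by omega⟩) * X (Sum.inr ⟨1, by omega⟩)
      + X (Sum.inl ⟨i, by omega⟩) * X (Sum.inr ⟨1, by omega⟩) ^ 2) =
    X 0 ^ (a - 2 - i) * X 1 ^ i * doubleDiagonal R := by
  subst hb
  obtain ⟨n, rfl⟩ := Nat.exists_eq_add_of_le hi
  simp only [map_add, map_sub, map_mul, map_pow, map_ofNat, toricMap_inl, toricMap_inr,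
    doubleDiagonal]
  rw [show i + 2 + n - (i + 2) = n by omega, show i + 2 + n - (i + 1) = n + 1 by omega,
    show i + 2 + n - i = n + 2 by omega, show i + 2 + n - 2 - i = n by omega]
  simp only [Nat.sub_zero, Nat.sub_self, pow_zero, pow_one]
  ring

theorem toricMap_quartic (ha : a = 1) (hb : b = 1) :
    toricMap R a b (X (Sum.inl ⟨1, by omega⟩) ^ 2 * X (Sum.inr ⟨0, by omega⟩) ^ 2
      - 2 * X (Sum.inl ⟨0, by omega⟩) * X (Sum.inl ⟨1, by omega⟩)
          * X (Sum.inr ⟨0, by omega⟩) * X (Sum.inr ⟨1, by omega⟩)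
      + X (Sum.inl ⟨0, by omega⟩) ^ 2 * X (Sum.inr ⟨1, by omega⟩) ^ 2) =
    doubleDiagonal R := by
  subst ha hb
  simp only [map_add, map_sub, map_mul, map_pow, map_ofNat, toricMap_inl, toricMap_inr,
    doubleDiagonal, Nat.sub_zero, Nat.sub_self, pow_zero, pow_one]
  ring

theorem toricMap_mem_of_mem_carpetIdeal {f : CoordPoly R a b} (hf : f ∈ carpetIdeal R a b) :
    toricMap R a b f ∈ Ideal.span {doubleDiagonal R} := by
  suffices h : carpetIdeal R a b ≤ (Ideal.span {doubleDiagonal R}).comap (toricMap R a b) from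
    h hf
  refine sup_le (sup_le ?_ ?_) ?_ <;> refine Ideal.span_le.2 ?_
  · rintro _ ⟨j, k, rfl⟩
    rw [SetLike.mem_coe, Ideal.mem_comap]
    convert! zero_mem (Ideal.span {doubleDiagonal R}) using 1
    obtain ⟨m, hm⟩ := Nat.exists_eq_add_of_lt j.2
    obtain ⟨n, hn⟩ := Nat.exists_eq_add_of_lt k.2
    simp only [Matrix.det_fin_two, MX, Matrix.submatrix_apply, id, Matrix.of_apply,
      Matrix.cons_val_zero, Matrix.cons_val_one, map_sub, map_mul, toricMap_inl, Fin.val_castSucc,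
      Fin.val_succ]
    rw [show a - (j : ℕ) = m + 1 by omega, show a - (k : ℕ) = n + 1 by omega,
      show a - ((j : ℕ) + 1) = m by omega, show a - ((k : ℕ) + 1) = n by omega]
    ring
  · rintro _ ⟨j, k, rfl⟩
    rw [SetLike.mem_coe, Ideal.mem_comap]
    convert! zero_mem (Ideal.span {doubleDiagonal R}) using 1
    obtain ⟨m, hm⟩ := Nat.exists_eq_add_of_lt j.2
    obtain ⟨n, hn⟩ := Nat.exists_eq_add_of_lt k.2
    simp only [Matrix.det_fin_two, MY, Matrix.submatrix_apply, id, Matrix.of_apply,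
      Matrix.cons_val_zero, Matrix.cons_val_one, map_sub, map_mul, toricMap_inr, Fin.val_castSucc,
      Fin.val_succ]
    rw [show b - (j : ℕ) = m + 1 by omega, show b - (k : ℕ) = n + 1 by omega,
      show b - ((j : ℕ) + 1) = m by omega, show b - ((k : ℕ) + 1) = n by omega]
    ring
  · rintro _ ((⟨i, j, hi, hj, rfl⟩ | ⟨i, hi, hb, rfl⟩) | ⟨ha, hb, rfl⟩) <;>
      rw [SetLike.mem_coe, Ideal.mem_comap]
    · rw [toricMap_bilinear hi hj]
      exact Ideal.mul_mem_left _ _ (Ideal.mem_span_singleton_self _)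
    · rw [toricMap_cubic hi hb]
      exact Ideal.mul_mem_left _ _ (Ideal.mem_span_singleton_self _)
    · rw [toricMap_quartic ha hb]
      exact Ideal.mem_span_singleton_self _

/-- Peel off one variable at a time: `x_a` while the exponent of `t` is at least `a`, otherwise the
`x_q` that uses up all of `t` and leaves a power of `s`. -/
theorem exists_toricMap_left (k : ℕ) : ∀ p q : ℕ, p + q = a * k →
    ∃ f, toricMap R a b f = X 0 ^ p * X 1 ^ q := by
  induction k with
  | zero =>
    intro p q h
    obtain ⟨rfl, rfl⟩ : p = 0 ∧ q = 0 := by omega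
    exact ⟨1, by simp⟩
  | succ k ih =>
    intro p q h
    rw [mul_add, mul_one] at h
    rcases le_total q a with hq | hq
    · obtain ⟨f, hf⟩ := ih (p - (a - q)) 0 (by omega)
      refine ⟨X (Sum.inl ⟨q, by omega⟩) * f, ?_⟩
      rw [map_mul, hf, toricMap_inl]
      obtain ⟨t, rfl⟩ := Nat.exists_eq_add_of_le (show a - q ≤ p by omega)
      simp only [Nat.add_sub_cancel_left]
      ring
    · obtain ⟨f, hf⟩ := ih p (q - a) (by omega)
      refine ⟨X (Sum.inl ⟨a, by omega⟩) * f, ?_⟩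
      rw [map_mul, hf, toricMap_inl]
      obtain ⟨t, rfl⟩ := Nat.exists_eq_add_of_le hq
      simp only [Nat.add_sub_cancel_left, Nat.sub_self]
      ring

theorem exists_toricMap_right (k : ℕ) : ∀ p q : ℕ, p + q = b * k →
    ∃ f, toricMap R a b f = X 2 ^ p * X 3 ^ q := by
  induction k with
  | zero =>
    intro p q h
    obtain ⟨rfl, rfl⟩ : p = 0 ∧ q = 0 := by omega
    exact ⟨1, by simp⟩
  | succ k ih =>
    intro p q h
    rw [mul_add, mul_one] at h
    rcases le_total q b with hq | hq
    · obtain ⟨f, hf⟩ := ih (p - (b - q)) 0 (by omega)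
      refine ⟨X (Sum.inr ⟨q, by omega⟩) * f, ?_⟩
      rw [map_mul, hf, toricMap_inr]
      obtain ⟨t, rfl⟩ := Nat.exists_eq_add_of_le (show b - q ≤ p by omega)
      simp only [Nat.add_sub_cancel_left]
      ring
    · obtain ⟨f, hf⟩ := ih p (q - b) (by omega)
      refine ⟨X (Sum.inr ⟨b, by omega⟩) * f, ?_⟩
      rw [map_mul, hf, toricMap_inr]
      obtain ⟨t, rfl⟩ := Nat.exists_eq_add_of_le hq
      simp only [Nat.add_sub_cancel_left, Nat.sub_self]
      ring

/-- The multiples of `(tu - sv)^2` in the bidegrees of the image come from the carpet ideal. -/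
theorem exists_mem_carpetIdeal_toricMap (hb : 1 ≤ b) (hab : b ≤ a) {m n p q r w : ℕ}
    (hm : p + q + 2 = a * m) (hn : r + w + 2 = b * n) :
    ∃ f ∈ carpetIdeal R a b, toricMap R a b f =
      X 0 ^ p * X 1 ^ q * (X 2 ^ r * X 3 ^ w) * doubleDiagonal R := by
  -- Splits off from a monomial with exponents `(p, q)` a factor with exponents `(c-2-i, i)`, the
  -- cofactor of the square in the image of a carpet generator. The remaining degree is a multiple
  -- of `c`, so the rest is in the image of the parametrization.
  have split (c k p q : ℕ) (hc : 2 ≤ c) (h : p + q + 2 = c * k) : ∃ i p' q' k', i + 2 ≤ c ∧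
      p = p' + (c - 2 - i) ∧ q = q' + i ∧ p' + q' = c * k' := by
    obtain ⟨k, rfl⟩ : ∃ k', k = k' + 1 := ⟨k - 1, by
      rcases k with _ | k
      · omega
      · rfl⟩
    rw [mul_add, mul_one] at h
    rcases le_total q (c - 2) with hq | hq
    · exact ⟨q, p - (c - 2 - q), 0, k, by omega, by omega, by omega, by omega⟩
    · exact ⟨c - 2, p, q - (c - 2), k, by omega, by omega, by omega, by omega⟩
  rcases Nat.lt_or_ge a 2 with ha | ha
  · obtain rfl : a = 1 := by omega
    obtain rfl : b = 1 := by omega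
    obtain ⟨f, hf⟩ := exists_toricMap_left (R := R) (a := 1) (b := 1) (p + q) p q (by omega)
    obtain ⟨g, hg⟩ := exists_toricMap_right (R := R) (a := 1) (b := 1) (r + w) r w (by omega)
    refine ⟨f * g * _, Ideal.mul_mem_left _ _
      (Ideal.mem_sup_right (Ideal.subset_span (Or.inr ⟨rfl, rfl, rfl⟩))), ?_⟩
    rw [map_mul, toricMap_quartic rfl rfl, map_mul, hf, hg]
  · obtain ⟨i, p', q', k, hi, rfl, rfl, hk⟩ := split a m p q ha hm
    obtain ⟨f, hf⟩ := exists_toricMap_left (R := R) (b := b) k p' q' hk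
    rcases Nat.lt_or_ge b 2 with hb2 | hb2
    · obtain rfl : b = 1 := by omega
      obtain ⟨g, hg⟩ := exists_toricMap_right (R := R) (a := a) (b := 1) (r + w) r w (by omega)
      refine ⟨f * g * _, Ideal.mul_mem_left _ _
        (Ideal.mem_sup_right (Ideal.subset_span (Or.inl (Or.inr ⟨i, hi, rfl, rfl⟩)))), ?_⟩
      rw [map_mul, toricMap_cubic hi rfl, map_mul, hf, hg]
      ring
    · obtain ⟨j, r', w', l, hj, rfl, rfl, hl⟩ := split b n r w hb2 hn
      obtain ⟨g, hg⟩ := exists_toricMap_right (R := R) (a := a) l r' w' hl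
      refine ⟨f * g * _, Ideal.mul_mem_left _ _
        (Ideal.mem_sup_right (Ideal.subset_span (Or.inl (Or.inl ⟨i, j, hi, hj, rfl⟩)))), ?_⟩
      rw [map_mul, toricMap_bilinear hi hj, map_mul, hf, hg]
      ring

end Toric

/-! ### The carpet ideal as a preimage. -/

section ToricKernel

variable (R : Type*) [CommRing R] (a b : ℕ)

/-- The class of `x_i` in the coordinate ring of the carpet, and `0` for `i > a`. -/
noncomputable def xClass (i : ℕ) : CoordPoly R a b ⧸ carpetIdeal R a b :=
  if h : i < a + 1 then Ideal.Quotient.mk _ (X (Sum.inl ⟨i, h⟩)) else 0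

/-- The class of `y_j` in the coordinate ring of the carpet, and `0` for `j > b`. -/
noncomputable def yClass (j : ℕ) : CoordPoly R a b ⧸ carpetIdeal R a b :=
  if h : j < b + 1 then Ideal.Quotient.mk _ (X (Sum.inr ⟨j, h⟩)) else 0

variable {R a b}

theorem xClass_val (i : Fin (a + 1)) :
    xClass R a b i = Ideal.Quotient.mk _ (X (Sum.inl i)) := by
  rw [xClass, dif_pos i.2]

theorem yClass_val (j : Fin (b + 1)) :
    yClass R a b j = Ideal.Quotient.mk _ (X (Sum.inr j)) := by
  rw [yClass, dif_pos j.2]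

theorem xClass_mul_xClass : ∀ i j k l, i ≤ a → j ≤ a → k ≤ a → l ≤ a → i + j = k + l →
    xClass R a b i * xClass R a b j = xClass R a b k * xClass R a b l := by
  refine mul_eq_mul_of_minors fun i j hi hj => ?_
  rw [xClass, xClass, xClass, xClass, dif_pos (by omega), dif_pos (by omega), dif_pos (by omega),
    dif_pos (by omega), ← map_mul, ← map_mul, Ideal.Quotient.mk_eq_mk_iff_sub_mem]
  refine Ideal.mem_sup_left (Ideal.mem_sup_left (Ideal.subset_span ⟨⟨i, hi⟩, ⟨j, hj⟩, ?_⟩))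
  simp [Matrix.det_fin_two, MX]
  ring

theorem yClass_mul_yClass : ∀ i j k l, i ≤ b → j ≤ b → k ≤ b → l ≤ b → i + j = k + l →
    yClass R a b i * yClass R a b j = yClass R a b k * yClass R a b l := by
  refine mul_eq_mul_of_minors fun i j hi hj => ?_
  rw [yClass, yClass, yClass, yClass, dif_pos (by omega), dif_pos (by omega), dif_pos (by omega),
    dif_pos (by omega), ← map_mul, ← map_mul, Ideal.Quotient.mk_eq_mk_iff_sub_mem]
  refine Ideal.mem_sup_left (Ideal.mem_sup_right (Ideal.subset_span ⟨⟨i, hi⟩, ⟨j, hj⟩, ?_⟩))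
  simp [Matrix.det_fin_two, MY]
  ring

variable (R a b)

/-- The value of `toricSection` on the monomial with exponents `e`. -/
noncomputable def toricSectionAux (e : Fin 4 →₀ ℕ) : CoordPoly R a b ⧸ carpetIdeal R a b :=
  if a ∣ e 0 + e 1 ∧ b ∣ e 2 + e 3 then
    normalProduct a (xClass R a b) ((e 0 + e 1) / a) (e 1) *
      normalProduct b (yClass R a b) ((e 2 + e 3) / b) (e 3)
  else 0

/-- The linear map from `R[s, t, u, v]` to the coordinate ring of the carpet that sends the
monomials in the image of `toricMap` to the classes of their preimages, and the other monomials
to `0`. -/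
noncomputable def toricSection :
    MvPolynomial (Fin 4) R →ₗ[R] CoordPoly R a b ⧸ carpetIdeal R a b :=
  (basisMonomials (Fin 4) R).constr R (toricSectionAux R a b)

variable {R a b}

/-- The exponent vector `(p, q, r, w)`. -/
noncomputable def exponents (p q r w : ℕ) : Fin 4 →₀ ℕ :=
  Finsupp.equivFunOnFinite.symm ![p, q, r, w]

theorem monomial_exponents (p q r w : ℕ) (c : R) :
    monomial (exponents p q r w) c = C c * (X 0 ^ p * X 1 ^ q * (X 2 ^ r * X 3 ^ w)) := by
  rw [monomial_eq, Finsupp.prod_fintype _ _ (by simp), Fin.prod_univ_four]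
  simp [exponents, mul_assoc]

theorem toricSection_monomial (p q r w : ℕ) (c : R) :
    toricSection R a b (C c * (X 0 ^ p * X 1 ^ q * (X 2 ^ r * X 3 ^ w))) =
      c • toricSectionAux R a b (exponents p q r w) := by
  have : C c * (X 0 ^ p * X 1 ^ q * (X 2 ^ r * X 3 ^ w)) =
      c • basisMonomials (Fin 4) R (exponents p q r w) := by
    rw [coe_basisMonomials, smul_monomial, smul_eq_mul, mul_one, monomial_exponents]
  rw [this, map_smul, toricSection, Module.Basis.constr_basis]

theorem toricSectionAux_exponents (p q r w : ℕ) :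
    toricSectionAux R a b (exponents p q r w) = if a ∣ p + q ∧ b ∣ r + w then
      normalProduct a (xClass R a b) ((p + q) / a) q *
        normalProduct b (yClass R a b) ((r + w) / b) w else 0 := rfl

/-- A term is congruent to the normal product determined by its image under `toricMap`. -/
theorem exists_toricMap_monomial (ha : 1 ≤ a) (hb : 1 ≤ b) (d : Fin (a + 1) ⊕ Fin (b + 1) →₀ ℕ)
    (c : R) : ∃ m q n w, ∃ r : R, q ≤ a * m ∧ w ≤ b * n ∧
      toricMap R a b (monomial d c) =
        C r * (X 0 ^ (a * m - q) * X 1 ^ q * (X 2 ^ (b * n - w) * X 3 ^ w)) ∧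
      Ideal.Quotient.mk (carpetIdeal R a b) (monomial d c) =
        r • (normalProduct a (xClass R a b) m q * normalProduct b (yClass R a b) n w) := by
  refine induction_on_monomial (motive := fun f => ∃ m q n w, ∃ r : R, q ≤ a * m ∧ w ≤ b * n ∧
      toricMap R a b f =
        C r * (X 0 ^ (a * m - q) * X 1 ^ q * (X 2 ^ (b * n - w) * X 3 ^ w)) ∧
      Ideal.Quotient.mk (carpetIdeal R a b) f =
        r • (normalProduct a (xClass R a b) m q * normalProduct b (yClass R a b) n w)) ?_ ?_ d c
  · intro c
    refine ⟨0, 0, 0, 0, c, by simp, by simp, ?_, ?_⟩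
    · rw [← algebraMap_eq, AlgHom.commutes, algebraMap_eq]
      simp
    · simp only [normalProduct, mul_zero, if_true, pow_zero, mul_one]
      exact Algebra.algebraMap_eq_smul_one (A := CoordPoly R a b ⧸ carpetIdeal R a b) c
  · rintro f (i | j) ⟨m, q, n, w, r, hq, hw, h1, h2⟩
    · have hi := i.2
      refine ⟨m + 1, q + i, n, w, r, by rw [mul_add]; omega, hw, ?_, ?_⟩
      · rw [map_mul, h1, toricMap_inl,
          show a * (m + 1) - (q + i) = (a * m - q) + (a - i) by rw [mul_add]; omega]
        ring
      · rw [map_mul, h2, ← xClass_val,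
          ← mul_normalProduct xClass_mul_xClass ha hq (by omega), smul_mul_assoc]
        congr 1
        ring
    · have hj := j.2
      refine ⟨m, q, n + 1, w + j, r, hq, by rw [mul_add]; omega, ?_, ?_⟩
      · rw [map_mul, h1, toricMap_inr,
          show b * (n + 1) - (w + j) = (b * n - w) + (b - j) by rw [mul_add]; omega]
        ring
      · rw [map_mul, h2, ← yClass_val,
          ← mul_normalProduct yClass_mul_yClass hb hw (by omega), smul_mul_assoc]
        congr 1
        ring

/-- The image of a monomial determines its degree and index sum in each group of variables, hence
its normal form modulo the carpet ideal. This is where the minors are used. -/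
theorem toricSection_toricMap (ha : 1 ≤ a) (hb : 1 ≤ b) (f : CoordPoly R a b) :
    toricSection R a b (toricMap R a b f) = Ideal.Quotient.mk _ f := by
  induction f using MvPolynomial.induction_on' with
  | monomial d c =>
    obtain ⟨m, q, n, w, r, hq, hw, h1, h2⟩ := exists_toricMap_monomial ha hb d c
    rw [h1, h2, toricSection_monomial, toricSectionAux_exponents, Nat.sub_add_cancel hq,
      Nat.sub_add_cancel hw, if_pos ⟨dvd_mul_right _ _, dvd_mul_right _ _⟩,
      Nat.mul_div_cancel_left _ ha, Nat.mul_div_cancel_left _ hb]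
  | add f g hf hg => rw [map_add, map_add, hf, hg, map_add]

/-- All three terms of a monomial multiple of the square have the same bidegree. If it is divisible
by `(a, b)`, the multiple is the image of an element of the carpet ideal; otherwise the section
kills each term. -/
theorem toricSection_mul_doubleDiagonal (hb : 1 ≤ b) (hab : b ≤ a) (g : MvPolynomial (Fin 4) R) :
    toricSection R a b (g * doubleDiagonal R) = 0 := by
  induction g using MvPolynomial.induction_on' with
  | monomial e c =>
    have he : e = exponents (e 0) (e 1) (e 2) (e 3) := by
      ext i
      fin_cases i <;> rfl
    rw [he, monomial_exponents]
    generalize e 0 = p, e 1 = q, e 2 = r, e 3 = w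
    by_cases h : a ∣ p + q + 2 ∧ b ∣ r + w + 2
    · obtain ⟨⟨m, hm⟩, n, hn⟩ := h
      obtain ⟨f, hf, hf'⟩ := exists_mem_carpetIdeal_toricMap (R := R) hb hab hm hn
      rw [mul_assoc, ← hf', ← smul_eq_C_mul, map_smul, toricSection_toricMap (hb.trans hab) hb,
        Ideal.Quotient.eq_zero_iff_mem.2 hf, smul_zero]
    · have e1 : C c * (X 0 ^ p * X 1 ^ q * (X 2 ^ r * X 3 ^ w)) * doubleDiagonal R =
          C c * (X 0 ^ p * X 1 ^ (q + 2) * (X 2 ^ (r + 2) * X 3 ^ w)) -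
          (2 : R) • (C c * (X 0 ^ (p + 1) * X 1 ^ (q + 1) * (X 2 ^ (r + 1) * X 3 ^ (w + 1)))) +
          C c * (X 0 ^ (p + 2) * X 1 ^ q * (X 2 ^ r * X 3 ^ (w + 2))) := by
        rw [smul_eq_C_mul, doubleDiagonal, map_ofNat C 2]
        ring
      have h1 : ¬ (a ∣ p + (q + 2) ∧ b ∣ r + 2 + w) := by
        rwa [show p + (q + 2) = p + q + 2 by omega, show r + 2 + w = r + w + 2 by omega]
      have h2 : ¬ (a ∣ p + 1 + (q + 1) ∧ b ∣ r + 1 + (w + 1)) := by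
        rwa [show p + 1 + (q + 1) = p + q + 2 by omega,
          show r + 1 + (w + 1) = r + w + 2 by omega]
      have h3 : ¬ (a ∣ p + 2 + q ∧ b ∣ r + (w + 2)) := by
        rwa [show p + 2 + q = p + q + 2 by omega, show r + (w + 2) = r + w + 2 by omega]
      rw [e1, map_add, map_sub, map_smul, toricSection_monomial, toricSection_monomial,
        toricSection_monomial, toricSectionAux_exponents, toricSectionAux_exponents,
        toricSectionAux_exponents, if_neg h1, if_neg h2, if_neg h3]
      simp
  | add f g hf hg => rw [add_mul, map_add, hf, hg, add_zero]

/-- The carpet ideal is the preimage of the ideal of the double diagonal. -/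
theorem mem_carpetIdeal_iff (hb : 1 ≤ b) (hab : b ≤ a) (f : CoordPoly R a b) :
    f ∈ carpetIdeal R a b ↔ toricMap R a b f ∈ Ideal.span {doubleDiagonal R} := by
  refine ⟨toricMap_mem_of_mem_carpetIdeal, fun h => ?_⟩
  obtain ⟨g, hg⟩ := Ideal.mem_span_singleton'.1 h
  rw [← Ideal.Quotient.eq_zero_iff_mem, ← toricSection_toricMap (hb.trans hab) hb, ← hg,
    toricSection_mul_doubleDiagonal hb hab]

end ToricKernel

/-! ### Flatness over the integers. -/

section TorsionFree

theorem coeff_doubleDiagonal (R : Type*) [CommRing R] :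
    coeff (exponents 0 2 2 0) (doubleDiagonal R) = 1 := by
  have e1 : doubleDiagonal R = monomial (exponents 0 2 2 0) 1 -
      monomial (exponents 1 1 1 1) 2 + monomial (exponents 2 0 0 2) 1 := by
    simp only [monomial_exponents, doubleDiagonal, map_ofNat C 2, C_1]
    ring
  have h1 : exponents 1 1 1 1 ≠ exponents 0 2 2 0 := fun h => by
    simpa [exponents] using DFunLike.congr_fun h 0
  have h2 : exponents 2 0 0 2 ≠ exponents 0 2 2 0 := fun h => by
    simpa [exponents] using DFunLike.congr_fun h 0
  rw [e1, coeff_add, coeff_sub, coeff_monomial, coeff_monomial, coeff_monomial, if_pos rfl,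
    if_neg h1, if_neg h2]
  simp

/-- A prime number stays prime in the polynomial ring and does not divide `doubleDiagonal`, which
has a coefficient 1. In `p g = q * doubleDiagonal` it must then divide `q` and cancels; induct over
the prime factors of `n`. -/
theorem mem_span_doubleDiagonal_of_mul {n : ℤ} (hn : n ≠ 0) {g : MvPolynomial (Fin 4) ℤ}
    (h : C n * g ∈ Ideal.span {doubleDiagonal ℤ}) : g ∈ Ideal.span {doubleDiagonal ℤ} := by
  induction n using UniqueFactorizationMonoid.induction_on_prime generalizing g with
  | h₁ => exact absurd rfl hn
  | h₂ u hu => exact (Ideal.unit_mul_mem_iff_mem _ (hu.map C)).1 h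
  | h₃ m p hm hp ih =>
    rw [map_mul, mul_assoc] at h
    refine ih hm ?_
    obtain ⟨q, hq⟩ := Ideal.mem_span_singleton'.1 h
    have hp' : Prime (C p : MvPolynomial (Fin 4) ℤ) := (prime_C_iff _).2 hp
    rcases hp'.dvd_or_dvd (Dvd.intro _ hq.symm) with ⟨q', rfl⟩ | hd
    · refine Ideal.mem_span_singleton'.2 ⟨q', mul_left_cancel₀ hp'.ne_zero ?_⟩
      rw [← hq, mul_assoc]
    · have := C_dvd_iff_dvd_coeff p _ |>.1 hd (exponents 0 2 2 0)
      rw [coeff_doubleDiagonal] at this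
      exact absurd (isUnit_of_dvd_one this) hp.not_isUnit

/-- The homogeneous coordinate ring of the carpet over `ℤ` is flat over `ℤ`. -/
theorem flat_carpet {a b : ℕ} (hb : 1 ≤ b) (hab : b ≤ a) :
    Module.Flat ℤ (CoordPoly ℤ a b ⧸ carpetIdeal ℤ a b) := by
  rw [IsDedekindDomain.flat_iff_torsion_eq_bot, eq_bot_iff]
  rintro z ⟨⟨n, hn⟩, hz⟩
  obtain ⟨f, rfl⟩ := Ideal.Quotient.mk_surjective z
  have hz' : n • Ideal.Quotient.mk (carpetIdeal ℤ a b) f = 0 := hz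
  rw [Submodule.mem_bot, Ideal.Quotient.eq_zero_iff_mem, mem_carpetIdeal_iff hb hab]
  refine mem_span_doubleDiagonal_of_mul (nonZeroDivisors.ne_zero hn) ?_
  rw [← map_zsmul, Ideal.Quotient.eq_zero_iff_mem, mem_carpetIdeal_iff hb hab, map_zsmul] at hz'
  rwa [← smul_eq_C_mul]

end TorsionFree

/-! ### Homogeneity of the carpet ideal. -/

section CarpetHomogeneous

variable {R : Type*} [CommRing R]

/-- The generators define a homogeneous map from a graded free module whose basis degrees are at
least `N`. Components can be taken upstairs, where they vanish below `N`. -/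
theorem components_of_mem_span {σ : Type*} {s : Set (MvPolynomial σ R)} {N : ℤ}
    (hs : ∀ g ∈ s, ∃ n, N ≤ n ∧ HomogeneousOfDegree g n) {p : MvPolynomial σ R}
    (hp : p ∈ Ideal.span s) (k : ℤ) :
    intComponent k p ∈ Ideal.span s ∧ (k < N → intComponent k p = 0) := by
  choose! deg hN hdeg using hs
  obtain ⟨v, rfl⟩ := (Finsupp.mem_span_iff_linearCombination _ _ _).1 hp
  let φ : (s →₀ MvPolynomial σ R) →ₗ[MvPolynomial σ R] (Unit →₀ MvPolynomial σ R) :=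
    Finsupp.linearCombination _ fun g => Finsupp.single () g.1
  have hφ : HomMap (fun g : s => deg g) (fun _ => 0) φ := fun g => by
    rw [Finsupp.linearCombination_single, one_smul]
    exact homVec_single (by simpa using hdeg g g.2)
  have hv (w) : φ w () = Finsupp.linearCombination (MvPolynomial σ R) Subtype.val w := by
    rw [linearMap_apply_eq_sum, linearMap_apply_eq_sum, Finsupp.finsetSum_apply]
    refine Finset.sum_congr rfl fun l _ => ?_
    simp [φ]
  have h := DFunLike.congr_fun (hφ.map_vecComp k v) ()
  rw [vecComp_apply, sub_zero, hv, hv] at h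
  rw [← h]
  refine ⟨(Finsupp.mem_span_iff_linearCombination _ _ _).2 ⟨_, rfl⟩, fun hk => ?_⟩
  have h0 : vecComp (fun g : s => deg g) k v = 0 := by
    ext1 l
    have := hN l l.2
    rw [vecComp_apply, intComponent, if_neg (by omega), Finsupp.zero_apply]
  rw [h0, map_zero]

theorem exists_homogeneousOfDegree_minor {σ : Type*} {n : ℕ}
    {M : Matrix (Fin 2) (Fin n) (MvPolynomial σ R)} (hM : ∀ i j, HomogeneousOfDegree (M i j) 1)
    (j k : Fin n) : HomogeneousOfDegree (M.submatrix id ![j, k]).det 2 := by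
  rw [Matrix.det_fin_two]
  exact ((hM _ _).mul (hM _ _)).sub ((hM _ _).mul (hM _ _))

variable (R) in
/-- The components of an element of the carpet ideal are in the ideal, and those of degree less
than `2` vanish. -/
theorem components_of_mem_carpetIdeal (a b : ℕ) {p : CoordPoly R a b}
    (hp : p ∈ carpetIdeal R a b) (k : ℤ) :
    intComponent k p ∈ carpetIdeal R a b ∧ (k < 2 → intComponent k p = 0) := by
  unfold carpetIdeal minorsIdeal at hp ⊢
  rw [← Ideal.span_union, ← Ideal.span_union] at hp ⊢
  refine components_of_mem_span ?_ hp k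
  have hx (i : Fin (a + 1) ⊕ Fin (b + 1)) := homogeneousOfDegree_X (R := R) i
  have h2 : HomogeneousOfDegree (2 : CoordPoly R a b) 0 := by
    rw [← map_ofNat C 2]
    simpa using homogeneousOfDegree_monomial (0 : Fin (a + 1) ⊕ Fin (b + 1) →₀ ℕ) (2 : R)
  rintro _ ((⟨j, k, rfl⟩ | ⟨j, k, rfl⟩) |
    ((⟨i, j, hi, hj, rfl⟩ | ⟨i, hi, hb, rfl⟩) | ⟨ha, hb, rfl⟩))
  · refine ⟨2, le_rfl, exists_homogeneousOfDegree_minor (fun i j => ?_) j k⟩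
    fin_cases i <;> exact hx _
  · refine ⟨2, le_rfl, exists_homogeneousOfDegree_minor (fun i j => ?_) j k⟩
    fin_cases i <;> exact hx _
  · exact ⟨2, le_rfl, (((hx _).mul (hx _)).sub ((h2.mul (hx _)).mul (hx _))).add
      ((hx _).mul (hx _))⟩
  · simp only [sq]
    exact ⟨3, by norm_num, (((hx _).mul ((hx _).mul (hx _))).sub
      (((h2.mul (hx _)).mul (hx _)).mul (hx _))).add ((hx _).mul ((hx _).mul (hx _)))⟩
  · simp only [sq]
    exact ⟨4, by norm_num, ((((hx _).mul (hx _)).mul ((hx _).mul (hx _))).sub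
      ((((h2.mul (hx _)).mul (hx _)).mul (hx _)).mul (hx _))).add
      (((hx _).mul (hx _)).mul ((hx _).mul (hx _)))⟩

theorem closedUnderComponents_carpetIdeal (a b : ℕ) :
    ClosedUnderComponents (carpetIdeal R a b) :=
  fun _ hp k => (components_of_mem_carpetIdeal R a b hp k).1

end CarpetHomogeneous

/-! ### Base change of free modules, of exact sequences and of strands. -/

section BaseChange

/-- Right exactness handles `A → B → range g → 0`. Flatness of the cokernel keeps the inclusion of
`range g` in `C` injective after tensoring. -/
theorem lTensor_exact_of_flat_coker {R A B C : Type*} [CommRing R] [AddCommGroup A] [Module R A]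
    [AddCommGroup B] [Module R B] [AddCommGroup C] [Module R C] {f : A →ₗ[R] B} {g : B →ₗ[R] C}
    (h : Function.Exact f g) [Module.Flat R (C ⧸ LinearMap.range g)]
    (M : Type*) [AddCommGroup M] [Module R M] :
    Function.Exact (f.lTensor M) (g.lTensor M) := by
  have h1 : Function.Exact f g.rangeRestrict := by
    rw [LinearMap.exact_iff, LinearMap.ker_rangeRestrict, h.linearMap_ker_eq]
  have h2 := lTensor_exact M h1 g.surjective_rangeRestrict
  have h3 := LinearMap.lTensor_injective_of_exact_of_flat (LinearMap.range g).mkQ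
    (LinearMap.range g).mkQ_surjective (LinearMap.range g).subtype Subtype.val_injective
    (LinearMap.exact_subtype_mkQ _) M
  intro x
  rw [← h2 x, ← map_eq_zero_iff _ h3, ← LinearMap.comp_apply, ← LinearMap.lTensor_comp]
  rfl

/-- Over a Dedekind domain flat means torsion-free, and this passes to submodules. -/
theorem flat_submodule {R M : Type*} [CommRing R] [IsDedekindDomain R] [AddCommGroup M]
    [Module R M] [Module.Flat R M] (N : Submodule R M) : Module.Flat R N := by
  have : Module.IsTorsionFree R N :=
    Subtype.val_injective.moduleIsTorsionFree (N.subtype : N → M) fun r x => rfl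
  rw [IsDedekindDomain.flat_iff_torsion_eq_bot]
  exact Submodule.isTorsionFree_iff_torsion_eq_bot.1 this

variable {R : Type*} [CommRing R] (K : Type*) [CommRing K] [Algebra R K] {σ : Type*}
  {ι κ : Type*}

/-- Change of coefficients of a vector of polynomials. -/
noncomputable def mapVec (v : ι →₀ MvPolynomial σ R) : ι →₀ MvPolynomial σ K :=
  v.mapRange (MvPolynomial.map (algebraMap R K)) (map_zero _)

@[simp]
theorem mapVec_apply (v : ι →₀ MvPolynomial σ R) (l : ι) :
    mapVec K v l = MvPolynomial.map (algebraMap R K) (v l) := rfl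

/-- Change of coefficients of a map of free modules over polynomial rings. -/
noncomputable def mapHom
    (φ : (ι →₀ MvPolynomial σ R) →ₗ[MvPolynomial σ R] (κ →₀ MvPolynomial σ R)) :
    (ι →₀ MvPolynomial σ K) →ₗ[MvPolynomial σ K] (κ →₀ MvPolynomial σ K) :=
  Finsupp.linearCombination _ fun m => mapVec K (φ (Finsupp.single m 1))

theorem mapHom_single
    (φ : (ι →₀ MvPolynomial σ R) →ₗ[MvPolynomial σ R] (κ →₀ MvPolynomial σ R)) (m : ι) :
    mapHom K φ (Finsupp.single m 1) = mapVec K (φ (Finsupp.single m 1)) := by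
  simp [mapHom]

theorem mapHom_mapVec
    (φ : (ι →₀ MvPolynomial σ R) →ₗ[MvPolynomial σ R] (κ →₀ MvPolynomial σ R))
    (v : ι →₀ MvPolynomial σ R) : mapHom K φ (mapVec K v) = mapVec K (φ v) := by
  induction v using Finsupp.induction_linear with
  | zero =>
    have h : mapVec K (0 : ι →₀ MvPolynomial σ R) = 0 := by ext1; simp
    have h' : mapVec K (0 : κ →₀ MvPolynomial σ R) = 0 := by ext1; simp
    rw [map_zero, h, h', map_zero]
  | add v w hv hw =>
    have h (v w : ι →₀ MvPolynomial σ R) : mapVec K (v + w) = mapVec K v + mapVec K w := by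
      ext1; simp
    have h' (v w : κ →₀ MvPolynomial σ R) : mapVec K (v + w) = mapVec K v + mapVec K w := by
      ext1; simp
    rw [map_add, h, h', map_add, hv, hw]
  | single l p =>
    have h1 : φ (Finsupp.single l p) = p • φ (Finsupp.single l 1) := by
      rw [← map_smul, Finsupp.smul_single, smul_eq_mul, mul_one]
    have h2 : mapVec K (Finsupp.single l p) =
        Finsupp.single l (MvPolynomial.map (algebraMap R K) p) := Finsupp.mapRange_single
    rw [h1, h2, mapHom, Finsupp.linearCombination_single]
    ext1 x
    simp

theorem HomogeneousOfDegree.map {p : MvPolynomial σ R} {n : ℤ} (h : HomogeneousOfDegree p n) :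
    HomogeneousOfDegree (MvPolynomial.map (algebraMap R K) p) n :=
  fun m hm => h m (support_map_subset _ _ hm)

theorem HomMap.mapHom {degι : ι → ℤ} {degκ : κ → ℤ}
    {φ : (ι →₀ MvPolynomial σ R) →ₗ[MvPolynomial σ R] (κ →₀ MvPolynomial σ R)}
    (h : HomMap degι degκ φ) : HomMap degι degκ (mapHom K φ) := by
  intro m
  rw [mapHom_single]
  exact fun l => (h m l).map K

open Classical in
variable (R ι σ) in
/-- Base change of a free module over a polynomial ring. -/
noncomputable def tensorVec :
    K ⊗[R] (ι →₀ MvPolynomial σ R) ≃ₗ[K] (ι →₀ MvPolynomial σ K) :=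
  finsuppRight R K K (MvPolynomial σ R) ι ≪≫ₗ
    Finsupp.mapRange.linearEquiv (algebraTensorAlgEquiv R K).toLinearEquiv

theorem tensorVec_tmul (c : K) (v : ι →₀ MvPolynomial σ R) :
    tensorVec R K σ ι (c ⊗ₜ v) = c • mapVec K v := by
  ext1 l
  simp [tensorVec]

/-- Identifies the matrix-wise change of coefficients with the tensor product, so that exactness can
be proved for the latter. -/
theorem tensorVec_lTensor
    (φ : (ι →₀ MvPolynomial σ R) →ₗ[MvPolynomial σ R] (κ →₀ MvPolynomial σ R))
    (x : K ⊗[R] (ι →₀ MvPolynomial σ R)) :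
    tensorVec R K σ κ ((φ.restrictScalars R).lTensor K x) = mapHom K φ (tensorVec R K σ ι x) := by
  induction x with
  | zero => simp
  | add x y hx hy => simp only [map_add, hx, hy]
  | tmul c v =>
    rw [LinearMap.lTensor_tmul, tensorVec_tmul, tensorVec_tmul, LinearMap.restrictScalars_apply,
      ← mapHom_mapVec, LinearMap.map_smul_of_tower]

theorem mapHom_exact {μ : Type*}
    {φ : (ι →₀ MvPolynomial σ R) →ₗ[MvPolynomial σ R] (κ →₀ MvPolynomial σ R)}
    {ψ : (κ →₀ MvPolynomial σ R) →ₗ[MvPolynomial σ R] (μ →₀ MvPolynomial σ R)}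
    (h : Function.Exact ((φ.restrictScalars R).lTensor K) ((ψ.restrictScalars R).lTensor K)) :
    Function.Exact (mapHom K φ) (mapHom K ψ) := by
  intro v
  obtain ⟨x, rfl⟩ := (tensorVec R K σ κ).surjective v
  rw [← tensorVec_lTensor, LinearEquiv.map_eq_zero_iff, h x]
  constructor
  · rintro ⟨y, rfl⟩
    exact ⟨_, (tensorVec_lTensor K φ y).symm⟩
  · rintro ⟨w, hw⟩
    obtain ⟨y, rfl⟩ := (tensorVec R K σ ι).surjective w
    rw [← tensorVec_lTensor] at hw
    exact ⟨y, (tensorVec R K σ κ).injective hw⟩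

open Classical in
theorem strandMap_mapHom (degι : ι → ℤ) (degκ : κ → ℤ) (k : ℤ)
    (φ : (ι →₀ MvPolynomial σ R) →ₗ[MvPolynomial σ R] (κ →₀ MvPolynomial σ R))
    (z : K ⊗[R] ({l : ι // degι l = k} →₀ R)) :
    finsuppScalarRight R K K _ ((strandMap degι degκ k φ).baseChange K z) =
      strandMap degι degκ k (mapHom K φ) (finsuppScalarRight R K K _ z) := by
  induction z with
  | zero => simp
  | add x y hx hy => simp only [map_add, hx, hy]
  | tmul c v =>
    induction v using Finsupp.induction_linear with
    | zero => simp
    | add x y hx hy => simp only [TensorProduct.tmul_add, map_add, hx, hy]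
    | single l r =>
      have h1 : finsuppScalarRight R K K {l : ι // degι l = k}
          (c ⊗ₜ Finsupp.single l r) = Finsupp.single l (r • c) := by
        rw [finsuppScalarRight_apply_tmul, Finsupp.sum_single_index (by simp)]
      rw [h1, LinearMap.baseChange_tmul]
      simp only [strandMap, Finsupp.linearCombination_single]
      ext1 x
      rw [finsuppScalarRight_apply_tmul_apply, Finsupp.smul_apply, Finsupp.smul_apply,
        strandVec_apply, strandVec_apply, mapHom_single, mapVec_apply, constantCoeff_map]
      simp only [Algebra.smul_def, map_mul, Algebra.algebraMap_self, RingHom.id_apply]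
      ring

end BaseChange

section QuotientBaseChange

variable {R : Type*} [CommRing R] (K : Type*) [CommRing K] [Algebra R K] {σ : Type*}
  (I : Ideal (MvPolynomial σ R))

/-- The map from `K[σ]` to the base change of the quotient `R[σ]/I`. -/
noncomputable def toTensorQuotient :
    MvPolynomial σ K →ₐ[K] K ⊗[R] (MvPolynomial σ R ⧸ I) :=
  (Algebra.TensorProduct.map (AlgHom.id K K) (Ideal.Quotient.mkₐ R I)).comp
    (algebraTensorAlgEquiv R K).symm.toAlgHom

theorem toTensorQuotient_map (p : MvPolynomial σ R) :
    toTensorQuotient K I (MvPolynomial.map (algebraMap R K) p) =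
      1 ⊗ₜ Ideal.Quotient.mk I p := by
  have := algebraTensorAlgEquiv_symm_map R K p
  simp [toTensorQuotient, this]

theorem toTensorQuotient_eq_zero {p : MvPolynomial σ K}
    (hp : p ∈ I.map (MvPolynomial.map (algebraMap R K))) : toTensorQuotient K I p = 0 := by
  have h : I.map (MvPolynomial.map (algebraMap R K)) ≤
      RingHom.ker (toTensorQuotient K I).toRingHom := by
    rw [Ideal.map_le_iff_le_comap]
    intro g hg
    have := toTensorQuotient_map K I g
    rw [Ideal.Quotient.eq_zero_iff_mem.2 hg, TensorProduct.tmul_zero] at this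
    exact this
  exact h hp

end QuotientBaseChange

/-! ### Base change of a resolution. -/

namespace GradedFreeResolution

variable {R : Type u} [CommRing R] {σ : Type v} {I : Ideal (MvPolynomial σ R)}
  (F : GradedFreeResolution.{w} I)

/-- A homogeneous lift to `P` of the augmentation. -/
noncomputable def augmentationLift :
    (F.ι 0 →₀ MvPolynomial σ R) →ₗ[MvPolynomial σ R] (Unit →₀ MvPolynomial σ R) :=
  F.exists_augmentation_lift.choose

theorem augmentationLift_homMap : HomMap (F.deg 0) (fun _ => 0) F.augmentationLift :=
  F.exists_augmentation_lift.choose_spec.1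

theorem ε_eq (v : F.ι 0 →₀ MvPolynomial σ R) :
    F.ε v = Ideal.Quotient.mk I (F.augmentationLift v ()) :=
  F.exists_augmentation_lift.choose_spec.2 v

variable (K : Type w') [CommRing K] [Algebra R K]

/-- Compares the tensored augmentation with the base-changed lift. Exactness at spot 0 then needs
only the map `toTensorQuotient`, not that it induces an isomorphism from the quotient of `K[σ]` by
the extended ideal. -/
theorem lTensor_ε_eq (x : K ⊗[R] (F.ι 0 →₀ MvPolynomial σ R)) :
    (F.ε.restrictScalars R).lTensor K x =
      toTensorQuotient K I (mapHom K F.augmentationLift (tensorVec R K σ _ x) ()) := by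
  induction x with
  | zero => simp
  | add x y hx hy => simp only [map_add, hx, hy, Finsupp.add_apply]
  | tmul c v =>
    rw [LinearMap.lTensor_tmul, tensorVec_tmul, LinearMap.map_smul_of_tower, mapHom_mapVec,
      Finsupp.smul_apply, map_smul, mapVec_apply, toTensorQuotient_map,
      LinearMap.restrictScalars_apply, ε_eq, TensorProduct.smul_tmul', smul_eq_mul, mul_one]

section

variable [IsDedekindDomain R] [Module.Flat R (MvPolynomial σ R ⧸ I)]

-- The first cokernel is `P/I`, flat by assumption. Every later one is the image of the preceding
-- differential, a submodule of a free module.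
include F in
theorem flat_coker_d (i : ℕ) : Module.Flat R
    ((F.ι i →₀ MvPolynomial σ R) ⧸ LinearMap.range ((F.d i).restrictScalars R)) := by
  cases i with
  | zero =>
    have h : Function.Exact ((F.d 0).restrictScalars R) (F.ε.restrictScalars R) := F.exact_zero
    rw [← h.linearMap_ker_eq]
    exact Module.Flat.of_linearEquiv
      ((F.ε.restrictScalars R).quotKerEquivOfSurjective F.ε_surjective)
  | succ i =>
    have h : Function.Exact ((F.d (i + 1)).restrictScalars R) ((F.d i).restrictScalars R) :=
      F.exact_succ i
    rw [← h.linearMap_ker_eq]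
    have := flat_submodule (LinearMap.range ((F.d i).restrictScalars R))
    exact Module.Flat.of_linearEquiv ((F.d i).restrictScalars R).quotKerEquivRange

theorem lTensor_exact_succ (i : ℕ) :
    Function.Exact (((F.d (i + 1)).restrictScalars R).lTensor K)
      (((F.d i).restrictScalars R).lTensor K) := by
  have h : Function.Exact ((F.d (i + 1)).restrictScalars R) ((F.d i).restrictScalars R) :=
    F.exact_succ i
  have := F.flat_coker_d i
  exact lTensor_exact_of_flat_coker h K

/-- The base change of a graded free resolution of a flat quotient `R[σ]/I` is a resolution. -/
noncomputable def baseChange :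
    GradedFreeResolution.{w} (I.map (MvPolynomial.map (algebraMap R K))) where
  ι := F.ι
  deg := F.deg
  d i := mapHom K (F.d i)
  ε := (I.map (MvPolynomial.map (algebraMap R K))).mkQ ∘ₗ Finsupp.lapply () ∘ₗ
    mapHom K F.augmentationLift
  d_homogeneous i := (F.d_homMap i).mapHom K
  ε_homogeneous l := by
    refine ⟨_, ?_, rfl⟩
    simpa using F.augmentationLift_homMap.mapHom K l ()
  ε_surjective := by
    intro z
    obtain ⟨p, rfl⟩ := Ideal.Quotient.mk_surjective z
    -- A vector over 1 remains over 1 after base change, and its multiples exhaust the quotient.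
    obtain ⟨v, hv⟩ := F.ε_surjective 1
    refine ⟨p • mapVec K v, ?_⟩
    replace hv : Ideal.Quotient.mk I (F.augmentationLift v ()) = Ideal.Quotient.mk I 1 :=
      (F.ε_eq v).symm.trans hv
    rw [Ideal.Quotient.mk_eq_mk_iff_sub_mem] at hv
    have h := Ideal.mem_map_of_mem (MvPolynomial.map (algebraMap R K)) hv
    rw [map_sub, ← Ideal.Quotient.mk_eq_mk_iff_sub_mem, map_one (MvPolynomial.map _)] at h
    rw [LinearMap.comp_apply, LinearMap.comp_apply, map_smul, mapHom_mapVec]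
    change Ideal.Quotient.mk _ (p * MvPolynomial.map (algebraMap R K) (F.augmentationLift v ())) = _
    rw [map_mul, h, map_one, mul_one]
  exact_zero := by
    intro v
    obtain ⟨x, rfl⟩ := (tensorVec R K σ _).surjective v
    -- Right exactness of the tensor product suffices here; flatness enters only at the positive
    -- spots.
    have hex : Function.Exact (((F.d 0).restrictScalars R).lTensor K)
        ((F.ε.restrictScalars R).lTensor K) :=
      lTensor_exact K (f := (F.d 0).restrictScalars R) (g := F.ε.restrictScalars R)
        F.exact_zero F.ε_surjective
    constructor
    · intro h
      have h1 := toTensorQuotient_eq_zero K I (Ideal.Quotient.eq_zero_iff_mem.1 h)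
      have h2 := F.lTensor_ε_eq K x
      rw [LinearMap.comp_apply, Finsupp.lapply_apply] at h1
      rw [h1, hex] at h2
      obtain ⟨y, rfl⟩ := h2
      exact ⟨_, (tensorVec_lTensor K _ y).symm⟩
    · rintro ⟨w, hw⟩
      rw [← hw]
      suffices h : (I.map (MvPolynomial.map (algebraMap R K))).mkQ ∘ₗ Finsupp.lapply () ∘ₗ
          mapHom K F.augmentationLift ∘ₗ mapHom K (F.d 0) = 0 from LinearMap.congr_fun h w
      refine Finsupp.lhom_ext' fun m => LinearMap.ext_ring ?_
      simp only [LinearMap.comp_apply, Finsupp.lsingle_apply, mapHom_single, mapHom_mapVec,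
        LinearMap.zero_apply, Finsupp.lapply_apply, mapVec_apply, Submodule.mkQ_apply]
      rw [Submodule.Quotient.mk_eq_zero]
      refine Ideal.mem_map_of_mem _ ?_
      rw [← Ideal.Quotient.eq_zero_iff_mem, ← ε_eq]
      exact F.exact_zero.apply_apply_eq_zero _
  exact_succ i := mapHom_exact K (F.lTensor_exact_succ K i)

open Classical in
/-- The terms of the constant strands of the base change. -/
noncomputable def strandEquiv (k : ℤ) (i : ℕ) :
    K ⊗[R] F.constantStrand k i ≃ₗ[K] (F.baseChange K).constantStrand k i :=
  finsuppScalarRight R K K {l : F.ι i // F.deg i l = k}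

theorem strandEquiv_baseChange (k : ℤ) (i : ℕ) (z : K ⊗[R] F.constantStrand k (i + 1)) :
    F.strandEquiv K k i ((F.constantStrandD k i).baseChange K z) =
      (F.baseChange K).constantStrandD k i (F.strandEquiv K k (i + 1) z) := by
  classical
  exact strandMap_mapHom K (F.deg (i + 1)) (F.deg i) k (F.d i) z

/-- The homology of `F^{(k)} ⊗ K` vanishes in a positive spot exactly if the constant strand of
the base change is exact there. -/
theorem subsingleton_strandHomology_iff (k : ℤ) (i : ℕ) :
    Subsingleton (F.strandHomology K k (i + 1)) ↔
      Function.Exact ((F.baseChange K).constantStrandD k (i + 1))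
        ((F.baseChange K).constantStrandD k i) := by
  refine Submodule.Quotient.subsingleton_iff.trans ?_
  rw [Submodule.submoduleOf, Submodule.comap_subtype_eq_top]
  have hc : ∀ z, (F.baseChange K).constantStrandD k i
      ((F.baseChange K).constantStrandD k (i + 1) z) = 0 := by
    intro z
    rw [← LinearMap.comp_apply, constantStrandD_eq, constantStrandD_eq,
      ← strandMap_comp ((F.baseChange K).d_homMap i), d_comp_d, strandMap_zero,
      LinearMap.zero_apply]
  constructor
  · intro h z
    refine ⟨fun hz => ?_, ?_⟩
    · obtain ⟨x, rfl⟩ := (F.strandEquiv K k (i + 1)).surjective z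
      rw [← strandEquiv_baseChange, LinearEquiv.map_eq_zero_iff] at hz
      obtain ⟨y, rfl⟩ := h (show x ∈ F.strandCycles K k (i + 1) from hz)
      exact ⟨_, (F.strandEquiv_baseChange K k (i + 1) y).symm⟩
    · rintro ⟨y, rfl⟩
      exact hc y
  · intro h x hx
    have hx' : (F.constantStrandD k i).baseChange K x = 0 := hx
    have h1 := F.strandEquiv_baseChange K k i x
    rw [hx', map_zero] at h1
    obtain ⟨z, hz⟩ := (h _).1 h1.symm
    obtain ⟨y, rfl⟩ := (F.strandEquiv K k (i + 2)).surjective z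
    rw [← strandEquiv_baseChange] at hz
    exact ⟨y, (F.strandEquiv K k (i + 1)).injective hz⟩

end

end GradedFreeResolution

theorem carpetIdeal_map (R : Type*) [CommRing R] (K : Type*) [CommRing K] [Algebra R K] (a b : ℕ) :
    (carpetIdeal R a b).map (MvPolynomial.map (algebraMap R K)) = carpetIdeal K a b := by
  unfold carpetIdeal minorsIdeal
  simp only [← Ideal.span_union, Ideal.map_span, Set.image_union]
  congr 4
  · ext q
    constructor
    · rintro ⟨_, ⟨j, k, rfl⟩, rfl⟩
      exact ⟨j, k, by simp [Matrix.det_fin_two, MX]⟩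
    · rintro ⟨j, k, rfl⟩
      exact ⟨_, ⟨j, k, rfl⟩, by simp [Matrix.det_fin_two, MX]⟩
  · ext q
    constructor
    · rintro ⟨_, ⟨j, k, rfl⟩, rfl⟩
      exact ⟨j, k, by simp [Matrix.det_fin_two, MY]⟩
    · rintro ⟨j, k, rfl⟩
      exact ⟨_, ⟨j, k, rfl⟩, by simp [Matrix.det_fin_two, MY]⟩
  · ext q
    constructor
    · rintro ⟨_, ⟨i, j, hi, hj, rfl⟩, rfl⟩
      exact ⟨i, j, hi, hj, by simp⟩
    · rintro ⟨i, j, hi, hj, rfl⟩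
      exact ⟨_, ⟨i, j, hi, hj, rfl⟩, by simp⟩
  · ext q
    constructor
    · rintro ⟨_, ⟨i, hi, hb, rfl⟩, rfl⟩
      exact ⟨i, hi, hb, by simp⟩
    · rintro ⟨i, hi, hb, rfl⟩
      exact ⟨_, ⟨i, hi, hb, rfl⟩, by simp⟩
  · ext q
    constructor
    · rintro ⟨_, ⟨ha, hb, rfl⟩, rfl⟩
      exact ⟨ha, hb, by simp⟩
    · rintro ⟨ha, hb, rfl⟩
      exact ⟨_, ⟨ha, hb, rfl⟩, by simp⟩

theorem carpetIdeal_ne_top (R : Type*) [CommRing R] [Nontrivial R] (a b : ℕ) :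
    carpetIdeal R a b ≠ ⊤ := by
  intro h
  have h1 : (1 : CoordPoly R a b) ∈ carpetIdeal R a b := h ▸ Submodule.mem_top
  have h2 := (components_of_mem_carpetIdeal R a b h1 0).2 (by norm_num)
  rw [homogeneousOfDegree_one.intComponent_eq, if_pos rfl] at h2
  exact one_ne_zero h2

/-! ### The linear strand of a minimal resolution, and the conclusion. -/

namespace GradedFreeResolution

section

variable {R : Type u} [CommRing R] {σ : Type v} {I : Ideal (MvPolynomial σ R)}

theorem constantStrand_exact_iff {J : Ideal (MvPolynomial σ R)} (h : I = J)
    (hI : ClosedUnderComponents I) (F : GradedFreeResolution.{w} I)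
    (G : GradedFreeResolution.{w'} J) (k : ℤ) (i : ℕ) :
    Function.Exact (F.constantStrandD k (i + 1)) (F.constantStrandD k i) ↔
      Function.Exact (G.constantStrandD k (i + 1)) (G.constantStrandD k i) := by
  subst h
  exact ⟨constantStrand_exact_of_exact hI F G k i, constantStrand_exact_of_exact hI G F k i⟩

theorem betti_eq_zero_iff [Nontrivial R] (F : GradedFreeResolution.{w} I) (i : ℕ) (k : ℤ) :
    F.betti i k = 0 ↔ ∀ l, F.deg i l ≠ k := by
  rw [betti, rank_finsupp_self, Cardinal.lift_eq_zero, Cardinal.mk_eq_zero_iff, isEmpty_subtype]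

variable {F : GradedFreeResolution.{w} I}

theorem IsMinimal.constantStrandD_eq_zero (hF : F.IsMinimal) (k : ℤ) (i : ℕ) :
    F.constantStrandD k i = 0 := by
  refine Finsupp.lhom_ext' fun m => LinearMap.ext_ring ?_
  ext x
  simp only [constantStrandD_eq, strandMap, LinearMap.comp_apply, Finsupp.lsingle_apply,
    Finsupp.linearCombination_single, one_smul, strandVec_apply, LinearMap.zero_apply,
    Finsupp.zero_apply]
  exact hF i m.1 x.1

/-- Both differentials of the strand vanish, so exactness means that the middle term is zero. -/
theorem IsMinimal.exact_iff_betti [Nontrivial R] (hF : F.IsMinimal) (k : ℤ) (i : ℕ) :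
    Function.Exact (F.constantStrandD k (i + 1)) (F.constantStrandD k i) ↔
      F.betti (i + 1) k = 0 := by
  rw [hF.constantStrandD_eq_zero, hF.constantStrandD_eq_zero, betti_eq_zero_iff]
  constructor
  · intro h l hl
    obtain ⟨_, h2⟩ := (h (Finsupp.single ⟨l, hl⟩ 1)).1 rfl
    exact one_ne_zero (Finsupp.single_eq_zero.1 h2.symm)
  · intro h z
    have : IsEmpty {l // F.deg (i + 1) l = k} := ⟨fun l => h l.1 l.2⟩
    exact ⟨fun _ => ⟨0, Subsingleton.elim _ _⟩, fun _ => rfl⟩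

theorem IsMinimal.constantCoeff_d (hF : F.IsMinimal) (i : ℕ)
    (x : F.ι (i + 1) →₀ MvPolynomial σ R) (l : F.ι i) : constantCoeff (F.d i x l) = 0 := by
  rw [linearMap_apply_eq_sum, Finsupp.finsetSum_apply, map_sum]
  refine Finset.sum_eq_zero fun m _ => ?_
  rw [Finsupp.smul_apply, smul_eq_mul, map_mul, hF i m l, mul_zero]

/-- If `d` killed the basis element `m`, exactness would make `m` a boundary, whose entry 1
contradicts minimality. A nonzero entry without constant term has positive degree. -/
theorem IsMinimal.exists_entry_ne_zero [Nontrivial R] (hF : F.IsMinimal) (i : ℕ)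
    (m : F.ι (i + 1)) :
    ∃ l, F.d i (Finsupp.single m 1) l ≠ 0 ∧ F.deg i l < F.deg (i + 1) m := by
  have h0 : F.d i (Finsupp.single m 1) ≠ 0 := by
    intro h
    obtain ⟨x, hx⟩ := (F.exact_succ i _).1 h
    have := hF.constantCoeff_d (i + 1) x m
    rw [hx, Finsupp.single_eq_same, map_one] at this
    exact one_ne_zero this
  obtain ⟨l, hl⟩ := Finsupp.ne_iff.1 h0
  refine ⟨l, hl, ?_⟩
  obtain ⟨e, he⟩ := ne_zero_iff.1 hl
  have hdeg := F.d_homogeneous i m l e (mem_support_iff.2 he)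
  have hpos : e.degree ≠ 0 := by
    intro hz
    rw [Finsupp.degree_eq_zero_iff] at hz
    subst hz
    exact he (hF i m l)
  omega

/-- In the minimal resolution of an ideal without elements of degree less than `2`, the basis
elements of the `i`-th term have degree at least `i + 1`, for `i ≥ 1`. -/
theorem IsMinimal.le_deg [Nontrivial R] (hF : F.IsMinimal) (h0 : ∀ l, F.deg 0 l = 0)
    (hε : ∀ v l, F.ε v = 0 → v l ∈ I) (hI : ∀ p ∈ I, ∀ k < 2, intComponent k p = 0) (i : ℕ)
    (m : F.ι (i + 1)) : (i : ℤ) + 2 ≤ F.deg (i + 1) m := by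
  induction i with
  | zero =>
    obtain ⟨l, hl, -⟩ := hF.exists_entry_ne_zero 0 m
    by_contra hlt
    refine hl ?_
    have h1 := F.d_homogeneous 0 m l
    rw [h0, sub_zero] at h1
    have h2 := hI _ (hε _ l (F.exact_zero.apply_apply_eq_zero (Finsupp.single m 1)))
      (F.deg 1 m) (by push_cast at hlt; omega)
    rwa [h1.intComponent_eq, if_pos rfl] at h2
  | succ i ih =>
    obtain ⟨l, -, hl⟩ := hF.exists_entry_ne_zero (i + 1) m
    have := ih l
    push_cast
    omega

/-- The linear strand of a minimal resolution has no gaps. -/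
theorem IsMinimal.betti_eq_zero_of_le [Nontrivial R] (hF : F.IsMinimal)
    (hdeg : ∀ (i : ℕ) (m : F.ι (i + 1)), (i : ℤ) + 2 ≤ F.deg (i + 1) m) {n i : ℕ}
    (h : F.betti (n + 1) (n + 2) = 0) (hi : n ≤ i) : F.betti (i + 1) (i + 2) = 0 := by
  induction i, hi using Nat.le_induction with
  | base => exact h
  | succ i _ ih =>
    rw [betti_eq_zero_iff] at ih ⊢
    intro m hm
    -- A generator of degree `i + 3` yields one of smaller degree in the previous term. That degree
    -- is at least `i + 2`, hence equal to it, which the induction hypothesis excludes.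
    obtain ⟨l, -, hl⟩ := hF.exists_entry_ne_zero (i + 1) m
    have h1 := hdeg i l
    have h2 := ih l
    push_cast at hm
    omega

end

end GradedFreeResolution

/-- Green's conjecture for the carpet over a field is equivalent to exactness of the constant
strand of degree `a + 1` at the `a`-th spot, for one graded free resolution. -/
theorem satisfiesGreen_iff_exact (K : Type u) [Field K] {n b : ℕ} (hb : b ≤ n + 1)
    {I : Ideal (CoordPoly K (n + 1) b)} (hI : I = carpetIdeal K (n + 1) b)
    (F : GradedFreeResolution.{w} I) :
    SatisfiesGreen K (n + 1) b ↔
      Function.Exact (F.constantStrandD (n + 2) (n + 1)) (F.constantStrandD (n + 2) n) := by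
  -- The ideal is a variable because a base-changed resolution resolves the extended ideal, which is
  -- equal to the carpet ideal only by a theorem (`carpetIdeal_map`).
  subst hI
  have hI := closedUnderComponents_carpetIdeal (R := K) (n + 1) b
  constructor
  · rintro ⟨G, hG, hβ⟩
    rw [GradedFreeResolution.constantStrand_exact_iff rfl hI F G, hG.exact_iff_betti]
    have := hβ (n + 1) (by omega)
    rwa [show ((n + 1 : ℕ) : ℤ) + 1 = n + 2 by push_cast; ring] at this
  · intro h
    obtain ⟨G, h0, hε, hu⟩ := GradedFreeResolution.exists_minimal.{0} _ hI
      (carpetIdeal_ne_top K (n + 1) b)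
    have hG : G.IsMinimal := fun i m l => by
      by_contra hne
      exact hu i m l (isUnit_iff_ne_zero.2 hne)
    rw [GradedFreeResolution.constantStrand_exact_iff rfl hI F G, hG.exact_iff_betti] at h
    refine ⟨G, hG, fun i hi => ?_⟩
    obtain ⟨j, rfl⟩ : ∃ j, i = j + 1 := ⟨i - 1, by omega⟩
    have := hG.betti_eq_zero_of_le (hG.le_deg h0 hε fun p hp k hk =>
      (components_of_mem_carpetIdeal K (n + 1) b hp k).2 hk) h (i := j) (by omega)
    rwa [show ((j + 1 : ℕ) : ℤ) + 1 = j + 2 by push_cast; ring]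

theorem satisfiesGreen_iff_subsingleton_strandHomology {a b : ℕ} (hb : 1 ≤ b) (hab : b ≤ a)
    (K : Type u) [Field K] (F : GradedFreeResolution.{w} (carpetIdeal ℤ a b)) :
    SatisfiesGreen K a b ↔ Subsingleton (F.strandHomology K (a + 1) a) := by
  -- As `a ≥ 1`, spot `a` is positive and its cycles are the kernel of a differential.
  obtain ⟨n, rfl⟩ : ∃ n, a = n + 1 := ⟨a - 1, by omega⟩
  have := flat_carpet hb hab
  rw [F.subsingleton_strandHomology_iff K,
    satisfiesGreen_iff_exact K hab (carpetIdeal_map ℤ K (n + 1) b) (F.baseChange K),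
    show ((n + 1 : ℕ) : ℤ) + 1 = n + 2 by push_cast; ring]

end K3Carpet

theorem mainTheorem8 (a b : ℕ) (hb : 1 ≤ b) (hab : b ≤ a) (K : Type u) [Field K] :
    (K3Carpet.SatisfiesGreen K a b ↔
      ∀ F : K3Carpet.GradedFreeResolution.{w} (K3Carpet.carpetIdeal ℤ a b),
        Subsingleton (F.strandHomology K (a + 1) a)) ∧
    (∀ F : K3Carpet.GradedFreeResolution.{w} (K3Carpet.carpetIdeal ℤ a b),
      K3Carpet.SatisfiesGreen K a b ↔ Subsingleton (F.strandHomology K (a + 1) a)) := by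
  have key := K3Carpet.satisfiesGreen_iff_subsingleton_strandHomology.{w} hb hab K
  refine ⟨⟨fun h F => (key F).1 h, fun h => ?_⟩, key⟩
  -- Some resolution over `ℤ` must exist, or the condition on all resolutions would be vacuous.
  obtain ⟨F, -⟩ := K3Carpet.GradedFreeResolution.exists_minimal.{w} _
    (K3Carpet.closedUnderComponents_carpetIdeal (R := ℤ) a b)
    (K3Carpet.carpetIdeal_ne_top ℤ a b)
  exact (key F).2 (h F)
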